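/- Let $\omega=e^{2\pi \mathrm i/3}$ and $$p_3(X,Y)=\frac1{27}\sum_{k,l,n=1}^{3}\omega^{kln}X_k^nY_l^n .$$ Let $\beta_q$ be the supremum of $\psi^*p_3(X,Y)\psi$ over all Hilbert spaces $\mathcal H$, all unit vectors $\psi\in\mathcal H$ and all unitaries $X_1,X_2,X_3,Y_1,Y_2,Y_3$ on $\mathcal H$ with $X_i^3=Y_j^3=I$ and $X_iY_j=Y_jX_i$ for all $i,j$. Let $G=\langle X_1,X_2,X_3 : X_i^3=1,\ X_iX_jX_k=X_kX_iX_j \text{ for all pairwise distinct } i,j,k\rangle$, a group of order 81. For elements $x=(x_1,x_2,x_3)$ of any group put $$\gamma_1(x)=x_1^2x_2^2,\qquad \gamma_2(x)=x_1^2x_3(x_3x_2^{-1}x_3^{-1}x_2)^2x_3,$$ $$\gamma_3(x)=x_1(x_2x_3x_2^{-1}x_3^{-1})^4x_2x_3,\qquad \gamma_4(x)=(x_2^{-1}x_3^{-1}x_2x_3)^4 .$$ Evaluated at the generators of $G$, these give elements $\gamma_1,\dots,\gamma_4\in G$ such that every element of $G$ is uniquely of the form $\gamma_1^{j_1}\gamma_2^{j_2}\gamma_3^{j_3}\gamma_4^{j_4}$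 with $j\in\{0,1,2\}^4$. Then there is an absolute constant $C>0$ such that the following holds for all $n_A,n_B$ and all $\varepsilon$. Let $X_1,X_2,X_3\in U_{n_A}(\mathbb C)$ and $Y_1,Y_2,Y_3\in U_{n_B}(\mathbb C)$ satisfy $X_i^3=I$ and $Y_i^3=I$, and let $\psi\in\mathbb C^{n_A}\otimes\mathbb C^{n_B}$ be a unit vector with $$\beta_q-\psi^*p_3(X\otimes I,I\otimes Y)\psi\le\varepsilon .$$ Define $f_A:G\to U_{n_A}(\mathbb C)$ and $f_B:G\to U_{n_B}(\mathbb C)$ by $$f_A\Big(\prod_{i=1}^4\gamma_i^{j_i}\Big)=\prod_{i=1}^4\gamma_i(X_1,X_2,X_3)^{j_i},\qquad f_B\Big(\prod_{i=1}^4\gamma_i^{j_i}\Big)=\prod_{i=1}^4\gamma_i(Y_1,Y_2,Y_3)^{j_i}\qquad (j\in\{0,1,2\}^4),$$ with the products taken in the order $i=1,2,3,4$. Then $f_A$ and $f_B$ are $(C\varepsilon,\psi)$-representations of $G$, that is, $$\frac1{|G|^2}\sum_{x,y\in G}\big\|f_A(x)f_A(y)^*-f_A(xy^{-1})\big\|_{R_A}^2\le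 C\varepsilon,\qquad \frac1{|G|^2}\sum_{x,y\in G}\big\|f_B(x)f_B(y)^*-f_B(xy^{-1})\big\|_{R_B}^2\le C\varepsilon,$$ where $\|A\|_R^2=\mathrm{Tr}(AA^*R)$, $R_A=\mathrm{Tr}_B(\psi\psi^*)$ and $R_B=\mathrm{Tr}_A(\psi\psi^*)$. -/

import Mathlib

open scoped Kronecker Matrix

noncomputable section

namespace CHSHMod3

/-! ### The Bell polynomial and the maximal quantum value

The observables `X₁, X₂, X₃` (and `Y₁, Y₂, Y₃`) are indexed by `Fin 3`, the index `k : Fin 3`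
standing for the question `k + 1 ∈ {1, 2, 3}`. -/

/-- The primitive third root of unity `ω = exp(2πi/3)`. -/
def omega : ℂ := Complex.exp (2 * Real.pi * Complex.I / 3)

/-- `p₃(X, Y) = (1/27) ∑_{k,l,n=1}^{3} ω^{kln} Xₖⁿ Yₗⁿ`, evaluated in a complex algebra. -/
def chshPoly {R : Type*} [Ring R] [Algebra ℂ R] (X Y : Fin 3 → R) : R :=
  (1 / 27 : ℂ) • ∑ k : Fin 3, ∑ l : Fin 3, ∑ n ∈ Finset.Icc 1 3,
    omega ^ (((k : ℕ) + 1) * ((l : ℕ) + 1) * n) • (X k ^ n * Y l ^ n)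

/-- Feasible commuting observables in a `*`-algebra: unitaries of order dividing three, such that
every `Xᵢ` commutes with every `Yⱼ`. -/
structure IsFeasible {R : Type*} [Ring R] [StarRing R] (X Y : Fin 3 → R) : Prop where
  unitary_X : ∀ i, X i ∈ unitary R
  unitary_Y : ∀ i, Y i ∈ unitary R
  cube_X : ∀ i, X i ^ 3 = 1
  cube_Y : ∀ i, Y i ^ 3 = 1
  commute : ∀ i j, X i * Y j = Y j * X i

/-- The values `ψ* p₃(X, Y) ψ` of all feasible strategies `(X, Y, ψ)` on all Hilbert spaces. -/
def quantumValues : Set ℝ :=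
  {v : ℝ | ∃ (H : Type) (_ : NormedAddCommGroup H) (_ : InnerProductSpace ℂ H)
      (_ : CompleteSpace H) (X Y : Fin 3 → (H →L[ℂ] H)) (ψ : H),
      IsFeasible X Y ∧ ‖ψ‖ = 1 ∧ v = (inner ℂ ψ (chshPoly X Y ψ)).re}

/-- The maximal quantum value `β_q`. -/
def betaQ : ℝ := sSup quantumValues

/-! ### State-dependent approximate representations -/

/-- The value `ψ* p₃(X ⊗ I, I ⊗ Y) ψ` of a finite-dimensional tensor product strategy. -/
def strategyValue {nA nB : ℕ} (X : Fin 3 → Matrix (Fin nA) (Fin nA) ℂ)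
    (Y : Fin 3 → Matrix (Fin nB) (Fin nB) ℂ) (ψ : EuclideanSpace ℂ (Fin nA × Fin nB)) : ℝ :=
  (star (ψ : Fin nA × Fin nB → ℂ) ⬝ᵥ
    (chshPoly (fun i => X i ⊗ₖ (1 : Matrix (Fin nB) (Fin nB) ℂ))
      (fun i => (1 : Matrix (Fin nA) (Fin nA) ℂ) ⊗ₖ Y i) *ᵥ (ψ : Fin nA × Fin nB → ℂ))).re

/-- The partial trace over the second tensor factor. -/
def partialTraceB {m n : Type*} [Fintype n] (M : Matrix (m × n) (m × n) ℂ) : Matrix m m ℂ :=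
  Matrix.of fun i j => ∑ k, M (i, k) (j, k)

/-- The partial trace over the first tensor factor. -/
def partialTraceA {m n : Type*} [Fintype m] (M : Matrix (m × n) (m × n) ℂ) : Matrix n n ℂ :=
  Matrix.of fun i j => ∑ k, M (k, i) (k, j)

/-- The rank-one operator `ψψ*`. -/
def pureDensity {ι : Type*} [Fintype ι] (ψ : EuclideanSpace ℂ ι) : Matrix ι ι ℂ :=
  Matrix.vecMulVec (ψ : ι → ℂ) (star (ψ : ι → ℂ))

/-- The squared state-dependent norm `‖A‖_R² = Tr(A A* R)`. -/
def normSqR {n : Type*} [Fintype n] (R A : Matrix n n ℂ) : ℝ :=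
  (A * Aᴴ * R).trace.re

/-- `f : G → Uₙ(ℂ)` satisfies
`|G|⁻² ∑_{x,y ∈ G} ‖f(x) f(y)* - f(x y⁻¹)‖_R² ≤ ε`. With `R` a reduced density matrix of `ψ`,
this says that `f` is an `(ε, ψ)`-representation. -/
def IsApproxRep {G : Type*} [Group G] [Fintype G] {n : Type*} [Fintype n] [DecidableEq n]
    (ε : ℝ) (R : Matrix n n ℂ) (f : G → Matrix.unitaryGroup n ℂ) : Prop :=
  (1 / (Fintype.card G : ℝ) ^ 2) * ∑ x : G, ∑ y : G,
    normSqR R ((f x : Matrix n n ℂ) * (f y : Matrix n n ℂ)ᴴ - (f (x * y⁻¹) : Matrix n n ℂ)) ≤ ε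

/-! ### The group `G` of order 81, its normal form, and the maps `f_A`, `f_B` -/

/-- The relators of `G`: `Xᵢ³`, and `Xᵢ Xⱼ Xₖ (Xₖ Xᵢ Xⱼ)⁻¹` for pairwise distinct `i, j, k`. -/
def relators : Set (FreeGroup (Fin 3)) :=
  {r | (∃ i, r = FreeGroup.of i ^ 3) ∨
    ∃ i j k, i ≠ j ∧ j ≠ k ∧ k ≠ i ∧
      r = FreeGroup.of i * FreeGroup.of j * FreeGroup.of k *
        (FreeGroup.of k * FreeGroup.of i * FreeGroup.of j)⁻¹}

/-- `G = ⟨X₁, X₂, X₃ : Xᵢ³ = 1, Xᵢ Xⱼ Xₖ = Xₖ Xᵢ Xⱼ for i ≠ j ≠ k ≠ i⟩`. -/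
abbrev G : Type := PresentedGroup relators

/-- The generators of `G`. -/
def gen (i : Fin 3) : G := PresentedGroup.of i

/-- The words `γ₁, …, γ₄` evaluated at a triple of elements of an arbitrary group. -/
def gammaWord {M : Type*} [Group M] (x : Fin 3 → M) : Fin 4 → M :=
  ![x 0 ^ 2 * x 1 ^ 2,
    x 0 ^ 2 * x 2 * (x 2 * (x 1)⁻¹ * (x 2)⁻¹ * x 1) ^ 2 * x 2,
    x 0 * (x 1 * x 2 * (x 1)⁻¹ * (x 2)⁻¹) ^ 4 * x 1 * x 2,
    ((x 1)⁻¹ * (x 2)⁻¹ * x 1 * x 2) ^ 4]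

/-- The normal-form word `γ₁^{j₁} γ₂^{j₂} γ₃^{j₃} γ₄^{j₄}` evaluated at a triple of group
elements. -/
def normalForm {M : Type*} [Group M] (x : Fin 3 → M) (j : Fin 4 → ℕ) : M :=
  gammaWord x 0 ^ j 0 * gammaWord x 1 ^ j 1 * gammaWord x 2 ^ j 2 * gammaWord x 3 ^ j 3

/-- The group `H ≅ C₃ × ((C₃ × C₃) ⋊ C₃)`: the element with coordinates `e₁, …, e₄` is
`γ₁^{e₁} γ₂^{e₂} γ₃^{e₃} γ₄^{e₄}`, where `γᵢ³ = 1`, `γ₃` and `γ₄` are central, and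
`γ₂ γ₁ = γ₄ γ₁ γ₂`. -/
@[ext]
structure H where
  e₁ : ZMod 3
  e₂ : ZMod 3
  e₃ : ZMod 3
  e₄ : ZMod 3
  deriving DecidableEq

namespace H

instance : Mul H :=
  ⟨fun a b => ⟨a.e₁ + b.e₁, a.e₂ + b.e₂, a.e₃ + b.e₃, a.e₄ + b.e₄ + a.e₂ * b.e₁⟩⟩

instance : One H := ⟨⟨0, 0, 0, 0⟩⟩

instance : Inv H := ⟨fun a => ⟨-a.e₁, -a.e₂, -a.e₃, -a.e₄ + a.e₂ * a.e₁⟩⟩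

theorem mul_def (a b : H) :
    a * b = ⟨a.e₁ + b.e₁, a.e₂ + b.e₂, a.e₃ + b.e₃, a.e₄ + b.e₄ + a.e₂ * b.e₁⟩ := rfl

theorem one_def : (1 : H) = ⟨0, 0, 0, 0⟩ := rfl

theorem inv_def (a : H) : a⁻¹ = ⟨-a.e₁, -a.e₂, -a.e₃, -a.e₄ + a.e₂ * a.e₁⟩ := rfl

instance : Group H :=
  Group.ofLeftAxioms
    (by intro a b c; simp only [mul_def, H.mk.injEq]; refine ⟨?_, ?_, ?_, ?_⟩ <;> ring)
    (by intro a; ext <;> simp [mul_def, one_def])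
    (by intro a; ext <;> simp [mul_def, one_def, inv_def])

/-- The exponents `(j₁, …, j₄) ∈ {0, 1, 2}⁴` of an element of `H`. -/
def exps (h : H) : Fin 4 → ℕ := ![h.e₁.val, h.e₂.val, h.e₃.val, h.e₄.val]

/-- `H` has the same elements as `C₃⁴`. -/
def equivProd : H ≃ ZMod 3 × ZMod 3 × ZMod 3 × ZMod 3 where
  toFun h := (h.e₁, h.e₂, h.e₃, h.e₄)
  invFun t := ⟨t.1, t.2.1, t.2.2.1, t.2.2.2⟩
  left_inv _ := rfl
  right_inv _ := rfl

instance : Fintype H := Fintype.ofEquiv _ equivProd.symm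

end H

theorem gen_cube (i : Fin 3) : gen i ^ 3 = 1 := by
  have h : (PresentedGroup.mk relators) (FreeGroup.of i ^ 3) = 1 :=
    PresentedGroup.one_of_mem (Or.inl ⟨i, rfl⟩)
  simpa [gen, PresentedGroup.of] using h

theorem gen_rel {i j k : Fin 3} (h₁ : i ≠ j) (h₂ : j ≠ k) (h₃ : k ≠ i) :
    gen i * gen j * gen k = gen k * gen i * gen j := by
  have h : (PresentedGroup.mk relators) (FreeGroup.of i * FreeGroup.of j * FreeGroup.of k *
        (FreeGroup.of k * FreeGroup.of i * FreeGroup.of j)⁻¹) = 1 :=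
    PresentedGroup.one_of_mem (Or.inr ⟨i, j, k, h₁, h₂, h₃, rfl⟩)
  rw [map_mul, map_inv, mul_inv_eq_one] at h
  simpa [gen, PresentedGroup.of] using h

/-- The images of the generators of `G` in `H`. -/
def genH : Fin 3 → H := ![⟨2, 2, 2, 1⟩, ⟨0, 1, 1, 0⟩, ⟨1, 0, 1, 1⟩]

theorem genH_rel : ∀ r ∈ relators, FreeGroup.lift genH r = 1 := by
  rintro r (⟨i, rfl⟩ | ⟨i, j, k, h₁, h₂, h₃, rfl⟩)
  · simp only [map_pow, FreeGroup.lift_apply_of]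
    fin_cases i <;> rfl
  · simp only [map_mul, map_inv, FreeGroup.lift_apply_of, mul_inv_eq_one]
    fin_cases i <;> fin_cases j <;> fin_cases k <;> first | rfl | simp at h₁ h₂ h₃

/-- The homomorphism `G → H` inverse to `φ`. -/
def toH : G →* H := PresentedGroup.toGroup genH_rel

theorem toH_gen (i : Fin 3) : toH (gen i) = genH i := PresentedGroup.toGroup.of genH_rel

theorem map_gammaWord {M N : Type*} [Group M] [Group N] (F : M →* N) (x : Fin 3 → M) (i : Fin 4) :
    F (gammaWord x i) = gammaWord (fun k => F (x k)) i := by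
  fin_cases i <;> simp [gammaWord]

theorem map_normalForm {M N : Type*} [Group M] [Group N] (F : M →* N) (x : Fin 3 → M)
    (j : Fin 4 → ℕ) : F (normalForm x j) = normalForm (fun k => F (x k)) j := by
  simp [normalForm, map_gammaWord]

theorem toH_normalForm (h : H) : toH (normalForm gen h.exps) = h := by
  rw [map_normalForm]
  simp only [toH_gen]
  obtain ⟨a, b, c, d⟩ := h
  fin_cases a <;> fin_cases b <;> fin_cases c <;> fin_cases d <;> rfl


theorem commute_p (i : Fin 3) : Commute (gen 0 * gen 1 * gen 2) (gen i) := by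
  have h1 : gen 0 * gen 1 * gen 2 = gen 2 * gen 0 * gen 1 :=
    gen_rel (by decide) (by decide) (by decide)
  have h2 : gen 0 * gen 1 * gen 2 = gen 1 * gen 2 * gen 0 :=
    h1.trans (gen_rel (by decide) (by decide) (by decide))
  have e0 : gen 0 * gen 1 * gen 2 * gen 0 = gen 0 * (gen 0 * gen 1 * gen 2) := by
    conv_rhs => rw [h2]
    simp only [mul_assoc]
  have e1 : gen 0 * gen 1 * gen 2 * gen 1 = gen 1 * (gen 0 * gen 1 * gen 2) := by
    conv_rhs => rw [h1]
    conv_lhs => rw [h2]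
    simp only [mul_assoc]
  have e2 : gen 0 * gen 1 * gen 2 * gen 2 = gen 2 * (gen 0 * gen 1 * gen 2) := by
    conv_lhs => rw [h1]
    simp only [mul_assoc]
  fin_cases i
  · exact e0
  · exact e1
  · exact e2

theorem commute_q (i : Fin 3) : Commute (gen 0 * gen 2 * gen 1) (gen i) := by
  have h1 : gen 0 * gen 2 * gen 1 = gen 1 * gen 0 * gen 2 :=
    gen_rel (by decide) (by decide) (by decide)
  have h2 : gen 0 * gen 2 * gen 1 = gen 2 * gen 1 * gen 0 :=
    h1.trans (gen_rel (by decide) (by decide) (by decide))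
  have e0 : gen 0 * gen 2 * gen 1 * gen 0 = gen 0 * (gen 0 * gen 2 * gen 1) := by
    conv_rhs => rw [h2]
    simp only [mul_assoc]
  have e1 : gen 0 * gen 2 * gen 1 * gen 1 = gen 1 * (gen 0 * gen 2 * gen 1) := by
    conv_lhs => rw [h1]
    simp only [mul_assoc]
  have e2 : gen 0 * gen 2 * gen 1 * gen 2 = gen 2 * (gen 0 * gen 2 * gen 1) := by
    conv_rhs => rw [h1]
    conv_lhs => rw [h2]
    simp only [mul_assoc]
  fin_cases i
  · exact e0
  · exact e1
  · exact e2

/-- The central element `(X₁ X₃ X₂) (X₁ X₂ X₃)⁻¹` of `G`. -/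
def zG : G := gen 0 * gen 2 * gen 1 * (gen 0 * gen 1 * gen 2)⁻¹

theorem commute_z (i : Fin 3) : Commute zG (gen i) :=
  (commute_q i).mul_left (commute_p i).inv_left

theorem zG_mul_p : zG * (gen 0 * gen 1 * gen 2) = gen 0 * gen 2 * gen 1 :=
  inv_mul_cancel_right _ _

theorem swap_cb : gen 2 * gen 1 = zG * gen 1 * gen 2 := by
  have h := zG_mul_p
  rw [mul_assoc (gen 0), mul_assoc (gen 0), ← mul_assoc, (commute_z 0).eq, mul_assoc] at h
  rw [mul_assoc]
  exact (mul_left_cancel h).symm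

theorem swap_ba : gen 1 * gen 0 = zG * gen 0 * gen 1 := by
  have h := zG_mul_p
  have h1 : gen 0 * gen 2 * gen 1 = gen 1 * gen 0 * gen 2 :=
    gen_rel (by decide) (by decide) (by decide)
  rw [h1, ← mul_assoc] at h
  rw [mul_assoc]
  exact (mul_right_cancel h).symm

theorem swap_ac : gen 0 * gen 2 = zG * gen 2 * gen 0 := by
  have h := zG_mul_p
  have h1 : gen 0 * gen 1 * gen 2 = gen 2 * gen 0 * gen 1 :=
    gen_rel (by decide) (by decide) (by decide)
  rw [h1, ← mul_assoc] at h
  rw [mul_assoc]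
  exact (mul_right_cancel h).symm

theorem pow_swap {M : Type*} [Group M] {x y z : M} (hzy : Commute z y)
    (h : y * x = z * x * y) (m : ℕ) : y ^ m * x = z ^ m * x * y ^ m := by
  induction m with
  | zero => simp
  | succ m ih =>
    calc y ^ (m + 1) * x = y * (y ^ m * x) := by rw [pow_succ', mul_assoc]
      _ = (y * z ^ m) * x * y ^ m := by rw [ih]; simp only [mul_assoc]
      _ = z ^ m * (y * x) * y ^ m := by rw [← (hzy.pow_left m).eq]; simp only [mul_assoc]
      _ = z ^ (m + 1) * x * y ^ (m + 1) := by
        rw [h, pow_succ z, pow_succ' y]; simp only [mul_assoc]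

theorem zG_cube : zG ^ 3 = 1 := by
  have h := pow_swap (commute_z 1) swap_ba 3
  rw [gen_cube, one_mul, mul_one] at h
  exact mul_eq_right.mp h.symm

theorem swap_ca : gen 2 * gen 0 = zG ^ 2 * gen 0 * gen 2 := by
  rw [mul_assoc, swap_ac]
  have : zG ^ 2 * (zG * gen 2 * gen 0) = zG ^ 3 * (gen 2 * gen 0) := by
    rw [pow_succ zG 2]; simp only [mul_assoc]
  rw [this, zG_cube, one_mul]

/-- The elements `X₁^i X₂^j X₃^k z^l` of `G`. -/
def IsMonomial (g : G) : Prop :=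
  ∃ i j k l : ℕ, g = gen 0 ^ i * gen 1 ^ j * gen 2 ^ k * zG ^ l

theorem IsMonomial.mul_z {g : G} (hg : IsMonomial g) (m : ℕ) : IsMonomial (g * zG ^ m) := by
  obtain ⟨i, j, k, l, rfl⟩ := hg
  exact ⟨i, j, k, l + m, by rw [pow_add]; simp only [mul_assoc]⟩

theorem IsMonomial.mul_gen {g : G} (hg : IsMonomial g) (r : Fin 3) : IsMonomial (g * gen r) := by
  obtain ⟨i, j, k, l, rfl⟩ := hg
  rw [mul_assoc, ((commute_z r).pow_left l).eq, ← mul_assoc]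
  apply IsMonomial.mul_z
  have e0 : IsMonomial (gen 0 ^ i * gen 1 ^ j * gen 2 ^ k * gen 0) := by
    refine ⟨i + 1, j, k, j + 2 * k, ?_⟩
    have hz : ∀ (m : ℕ) (x : G), Commute (zG ^ m) (gen 0 ^ i * gen 1 ^ j * gen 2 ^ k) := by
      intro m _
      exact ((((commute_z 0).pow_right i).mul_right ((commute_z 1).pow_right j)).mul_right
        ((commute_z 2).pow_right k)).pow_left m
    have h1 := pow_swap ((commute_z 2).pow_left 2) swap_ca k
    have h2 := pow_swap (commute_z 1) swap_ba j
    calc gen 0 ^ i * gen 1 ^ j * gen 2 ^ k * gen 0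
        = gen 0 ^ i * (gen 1 ^ j * (zG ^ 2) ^ k) * gen 0 * gen 2 ^ k := by
          rw [mul_assoc, h1]; simp only [mul_assoc]
      _ = gen 0 ^ i * (zG ^ 2) ^ k * (gen 1 ^ j * gen 0) * gen 2 ^ k := by
          rw [← ((((commute_z 1).pow_left 2).pow_left k).pow_right j).eq]; simp only [mul_assoc]
      _ = gen 0 ^ i * ((zG ^ 2) ^ k * zG ^ j) * gen 0 * gen 1 ^ j * gen 2 ^ k := by
          rw [h2]; simp only [mul_assoc]
      _ = gen 0 ^ i * zG ^ (j + 2 * k) * gen 0 * gen 1 ^ j * gen 2 ^ k := by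
          rw [← pow_mul, ← pow_add, add_comm]
      _ = zG ^ (j + 2 * k) * (gen 0 ^ (i + 1) * gen 1 ^ j * gen 2 ^ k) := by
          rw [← (((commute_z 0).pow_left (j + 2 * k)).pow_right i).eq, pow_succ]
          simp only [mul_assoc]
      _ = gen 0 ^ (i + 1) * gen 1 ^ j * gen 2 ^ k * zG ^ (j + 2 * k) :=
          ((((commute_z 0).pow_right (i + 1)).mul_right ((commute_z 1).pow_right j)).mul_right
            ((commute_z 2).pow_right k)).pow_left _
  have e1 : IsMonomial (gen 0 ^ i * gen 1 ^ j * gen 2 ^ k * gen 1) := by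
    refine ⟨i, j + 1, k, k, ?_⟩
    have h1 := pow_swap (commute_z 2) swap_cb k
    calc gen 0 ^ i * gen 1 ^ j * gen 2 ^ k * gen 1
        = gen 0 ^ i * gen 1 ^ j * zG ^ k * gen 1 * gen 2 ^ k := by
          rw [mul_assoc, h1]; simp only [mul_assoc]
      _ = zG ^ k * (gen 0 ^ i * gen 1 ^ (j + 1) * gen 2 ^ k) := by
          rw [← ((((commute_z 0).pow_right i).mul_right ((commute_z 1).pow_right j)).pow_left k).eq,
            pow_succ]
          simp only [mul_assoc]
      _ = gen 0 ^ i * gen 1 ^ (j + 1) * gen 2 ^ k * zG ^ k :=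
          ((((commute_z 0).pow_right i).mul_right ((commute_z 1).pow_right (j + 1))).mul_right
            ((commute_z 2).pow_right k)).pow_left _
  have e2 : IsMonomial (gen 0 ^ i * gen 1 ^ j * gen 2 ^ k * gen 2) :=
    ⟨i, j, k + 1, 0, by rw [pow_zero, mul_one, pow_succ, mul_assoc]⟩
  fin_cases r
  · exact e0
  · exact e1
  · exact e2

theorem isMonomial (g : G) : IsMonomial g := by
  have hg : g ∈ Subgroup.closure (Set.range (PresentedGroup.of (rels := relators))) := by
    rw [PresentedGroup.closure_range_of]; trivial
  induction hg using Subgroup.closure_induction_right with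
  | one => exact ⟨0, 0, 0, 0, by simp⟩
  | mul_right x _ y hy ih =>
    obtain ⟨r, rfl⟩ := hy
    exact ih.mul_gen r
  | mul_inv_cancel x _ y hy ih =>
    obtain ⟨r, rfl⟩ := hy
    have h : (PresentedGroup.of r : G)⁻¹ = gen r * gen r := by
      rw [inv_eq_iff_mul_eq_one]
      exact (by rw [pow_succ', pow_two] : gen r * (gen r * gen r) = gen r ^ 3).trans (gen_cube r)
    rw [h, ← mul_assoc]
    exact (ih.mul_gen r).mul_gen r

theorem toH_monomial : ∀ i j k l : Fin 3,
    genH 0 ^ (i : ℕ) * genH 1 ^ (j : ℕ) * genH 2 ^ (k : ℕ) *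
      (genH 0 * genH 2 * genH 1 * (genH 0 * genH 1 * genH 2)⁻¹) ^ (l : ℕ) = 1 →
    i = 0 ∧ j = 0 ∧ k = 0 ∧ l = 0 := by
  decide

theorem pow_eq_pow_fin {x : G} (hx : x ^ 3 = 1) (m : ℕ) : ∃ r : Fin 3, x ^ m = x ^ (r : ℕ) :=
  ⟨⟨m % 3, Nat.mod_lt _ (by norm_num)⟩, pow_eq_pow_mod m hx⟩

theorem toH_zG : toH zG = genH 0 * genH 2 * genH 1 * (genH 0 * genH 1 * genH 2)⁻¹ := by
  unfold zG
  rw [map_mul, map_inv, map_mul, map_mul, map_mul, map_mul, toH_gen, toH_gen, toH_gen]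

theorem toH_injective : Function.Injective toH := by
  rw [injective_iff_map_eq_one]
  intro g hg
  obtain ⟨i, j, k, l, h⟩ := isMonomial g
  obtain ⟨i', hi⟩ := pow_eq_pow_fin (gen_cube 0) i
  obtain ⟨j', hj⟩ := pow_eq_pow_fin (gen_cube 1) j
  obtain ⟨k', hk⟩ := pow_eq_pow_fin (gen_cube 2) k
  obtain ⟨l', hl⟩ := pow_eq_pow_fin zG_cube l
  rw [hi, hj, hk, hl] at h
  rw [h, map_mul, map_mul, map_mul, map_pow, map_pow, map_pow, map_pow, toH_zG, toH_gen, toH_gen,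
    toH_gen] at hg
  obtain ⟨h1, h2, h3, h4⟩ := toH_monomial i' j' k' l' hg
  subst h1 h2 h3 h4
  rw [h, Fin.val_zero, pow_zero, pow_zero, pow_zero, pow_zero, mul_one, mul_one, mul_one]

/-- The isomorphism `φ : H → G`. -/
def phi : H ≃* G :=
  (MulEquiv.ofBijective toH
    ⟨toH_injective, fun h => ⟨normalForm gen h.exps, toH_normalForm h⟩⟩).symm

/-- `φ` maps `γ₁^{j₁} γ₂^{j₂} γ₃^{j₃} γ₄^{j₄}` to the corresponding word in `X₁, X₂, X₃`. -/
theorem phi_apply (h : H) : phi h = normalForm gen h.exps :=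
  toH_injective (((MulEquiv.ofBijective toH _).apply_symm_apply h).trans (toH_normalForm h).symm)

instance : Fintype G := Fintype.ofEquiv H phi.toEquiv

/-- The map `f : G → M` with `f(φ(∏ᵢ γᵢ^{jᵢ})) = ∏ᵢ γᵢ(x₁, x₂, x₃)^{jᵢ}`, where `j ∈ {0, 1, 2}⁴`
and `x₁, x₂, x₃` are elements of a group `M` that need not satisfy the relations of `G`. -/
def fMap {M : Type*} [Group M] (x : Fin 3 → M) (g : G) : M :=
  normalForm x (phi.symm g).exps

/-- The defining equation of `f`. -/
theorem fMap_normalForm {M : Type*} [Group M] (x : Fin 3 → M) (j : Fin 4 → ℕ)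
    (hj : ∀ i, j i < 3) : fMap x (normalForm gen j) = normalForm x j := by
  have hv : ∀ i, ((j i : ℕ) : ZMod 3).val = j i := fun i => ZMod.val_cast_of_lt (hj i)
  have he : (⟨j 0, j 1, j 2, j 3⟩ : H).exps = j := by
    funext i
    fin_cases i <;> simp [H.exps, hv]
  have hp : phi.symm (normalForm gen j) = ⟨j 0, j 1, j 2, j 3⟩ := by
    rw [MulEquiv.symm_apply_eq, phi_apply, he]
  rw [fMap, hp, he]

end CHSHMod3

end

/-!
The maximal quantum value is `β = (τ + 3) / 9`, where `τ = 2√3 cos (π/18) = θ² + 2θ - 2` and `θ = 2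
cos (2π/9)`, and near-optimality forces the relations of `G` for the following reason.

**A one-sided certificate.** With `z_l = ω^{kl} X_k Y_l`, the Bell polynomial is `27 p₃ = 9 + ∑ₖ ∑_l
(z_l + z_l²)`, and for each `k` the `z_l` are again three unitaries of order three. The
noncommutative polynomial `τ - ∑_l (z_l + z_l²)` is not a sum of squares. But the monomials of
degree zero and weight nonzero modulo three, where `z_l` has degree one and weight `l`, cancel in
the sum over `k`, and up to such monomials it is: there are polynomials `nᵢ` and a positive definite
matrix `G` over `ℤ[θ]` (`certPoly`, in three blocks for the representations of `S₃`) such that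
`certScale · (τ - ∑_l (z_l + z_l²))` differs from `∑_σ ∑ᵢⱼ Gᵢⱼ (σ nᵢ)* (σ nⱼ)` only by them
(`offBalance_certPoly`). Positivity of `G` is diagonal dominance of `100 G - V Vᵀ` for an integer
matrix `V`. So `p₃ ≤ β` (`re_inner_chshPoly_le`), and at a vector whose value is within `ε` of `β`
all the vectors `(σ nᵢ)(z) ψ` have squared norm `O(ε)` (`sum_nullSum_le`). An explicit strategy on
two qutrits attains `β` (`beta_le_betaQ`), hence `β ≤ β_q`.

**From inequalities to algebra.** The families of vectors over all near-optimal strategies, modulo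
the families of squared norm `O(ε)`, form a vector space on which the observables act, and in which
the family of the states is annihilated by all `(σ nᵢ)(z)` exactly
(`NearOptimal.isNull_limitState`). An exact identity in this quotient is an estimate `‖·‖² ≤ C ε`
with a constant independent of the strategy. It remains to argue with an exact vector `ψ`.

**Exact algebra.** Some of the `nᵢ` say that `z_i z_j z_k ψ` depends only on the cyclic order of `i,
j, k` (`IsNull.cyclic`); as the other party's cubes drop out, the same holds for `X_i X_j X_k ψ`.
Others determine `∑_l z_l` on `ψ` as a polynomial in `(∑_l z_l)³`, from which `X_k` disappears;
hence `X_k ψ = b ψ` with `b` in the algebra generated by Bob's observables (`exists_transfer`). As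
`b` commutes with Alice's observables, the stabilizer of `ψ` in the free group on Alice's
observables is normal, so it contains the normal closure of the relators of `G`, and words that
agree in `G` act equally on `ψ` (`apply_eq_of_mk_eq`). Applied to the words that define `f(y)
f(x)⁻¹` and `f(x y⁻¹)⁻¹`, this bounds every summand in the definition of an approximate
representation, since `‖A‖_R = ‖A* ψ‖` for a reduced density matrix `R` of `ψ`.
-/

open scoped Kronecker Matrix

noncomputable section

namespace CHSHMod3

/-! ### Integers of the cubic field `ℚ(2 cos (2π/9))` -/

/-- The real number `θ = 2 cos (2π/9)`, a root of `θ³ = 3θ - 1`. -/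
def theta : ℝ := 2 * Real.cos (2 * Real.pi / 9)

theorem theta_cube : theta ^ 3 = 3 * theta - 1 := by
  have h := Real.cos_three_mul (2 * Real.pi / 9)
  rw [show 3 * (2 * Real.pi / 9) = Real.pi - Real.pi / 3 by ring, Real.cos_pi_sub,
    Real.cos_pi_div_three] at h
  unfold theta
  linear_combination (-2) * h

theorem one_lt_theta : 1 < theta := by
  have h : Real.cos (Real.pi / 3) < Real.cos (2 * Real.pi / 9) :=
    Real.cos_lt_cos_of_nonneg_of_le_pi (by positivity) (by linarith [Real.pi_pos])
      (by linarith [Real.pi_pos])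
  rw [Real.cos_pi_div_three] at h
  unfold theta
  linarith

/-- The integer `⌊10¹⁵ θ⌋`. -/
def thetaApprox : ℤ := 1532088886237956

theorem lt_theta : (thetaApprox : ℝ) / 10 ^ 15 < theta := by
  by_contra h
  have h1 := one_lt_theta
  have h2 := theta_cube
  have h3 : (thetaApprox : ℝ) / 10 ^ 15 = 1532088886237956 / 10 ^ 15 := by
    norm_num [thetaApprox]
  rw [h3] at h
  set s : ℝ := 1532088886237956 / 10 ^ 15 with hs
  have h4 : s ^ 3 - 3 * s + 1 < 0 := by rw [hs]; norm_num
  have h5 : 1 < s := by rw [hs]; norm_num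
  nlinarith [mul_nonneg (sub_nonneg.2 (not_lt.1 h))
    (show 0 ≤ theta ^ 2 + theta * s + s ^ 2 - 3 by nlinarith)]

theorem theta_lt : theta < ((thetaApprox : ℝ) + 1) / 10 ^ 15 := by
  by_contra h
  have h1 := one_lt_theta
  have h2 := theta_cube
  have h3 : ((thetaApprox : ℝ) + 1) / 10 ^ 15 = 1532088886237957 / 10 ^ 15 := by
    norm_num [thetaApprox]
  rw [h3] at h
  set s : ℝ := 1532088886237957 / 10 ^ 15 with hs
  have h4 : 0 < s ^ 3 - 3 * s + 1 := by rw [hs]; norm_num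
  have h5 : 1 < s := by rw [hs]; norm_num
  nlinarith [mul_nonneg (sub_nonneg.2 (not_lt.1 h))
    (show 0 ≤ theta ^ 2 + theta * s + s ^ 2 - 3 by nlinarith)]

/-- The element `a + bθ + cθ²` of `ℤ[θ]`. -/
structure CubicInt where
  a : ℤ
  b : ℤ
  c : ℤ

namespace CubicInt

/-- The real number represented by an element of `ℤ[θ]`. -/
def val (x : CubicInt) : ℝ := x.a + x.b * theta + x.c * theta ^ 2

def ofInt (n : ℤ) : CubicInt := ⟨n, 0, 0⟩

protected def add (x y : CubicInt) : CubicInt := ⟨x.a + y.a, x.b + y.b, x.c + y.c⟩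

protected def mul (x y : CubicInt) : CubicInt :=
  ⟨x.a * y.a - (x.b * y.c + x.c * y.b),
    x.a * y.b + x.b * y.a + 3 * (x.b * y.c + x.c * y.b) - x.c * y.c,
    x.a * y.c + x.b * y.b + x.c * y.a + 3 * (x.c * y.c)⟩

def isZero (x : CubicInt) : Bool := decide (x.a = 0) && decide (x.b = 0) && decide (x.c = 0)

theorem val_ofInt (n : ℤ) : (ofInt n).val = n := by simp [ofInt, val]

theorem val_add (x y : CubicInt) : (x.add y).val = x.val + y.val := by
  simp only [CubicInt.add, val]; push_cast; ring

theorem val_mul (x y : CubicInt) : (x.mul y).val = x.val * y.val := by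
  have h := theta_cube
  simp only [CubicInt.mul, val]
  push_cast
  linear_combination (-(x.b * y.c + x.c * y.b : ℝ) - x.c * y.c * theta) * h

theorem val_eq_zero {x : CubicInt} (h : x.isZero = true) : x.val = 0 := by
  simp only [isZero, Bool.and_eq_true, decide_eq_true_eq] at h
  simp [val, h.1.1, h.1.2, h.2]

/-- `10³⁰ (a + bθ + cθ²)` with `10¹⁵ θ` replaced by its integer part. -/
def approx (x : CubicInt) : ℤ :=
  x.a * (1000000000000000 * 1000000000000000) + x.b * (thetaApprox * 1000000000000000) +
    x.c * (thetaApprox * thetaApprox)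

/-- A bound for the error of `CubicInt.approx`. -/
def err (x : CubicInt) : ℤ := (|x.b| + 4 * |x.c|) * 1000000000000000

theorem abs_sub_approx_le (x : CubicInt) : |x.val * 10 ^ 30 - (x.approx : ℝ)| ≤ (x.err : ℝ) := by
  have h1 := lt_theta
  have h2 := theta_lt
  rw [div_lt_iff₀ (by positivity)] at h1
  rw [lt_div_iff₀ (by positivity)] at h2
  have h3 : (0 : ℝ) ≤ thetaApprox := by norm_num [thetaApprox]
  have h4 : (thetaApprox : ℝ) ≤ 1.6 * 10 ^ 15 := by norm_num [thetaApprox]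
  obtain ⟨d, hd⟩ : ∃ d : ℝ, theta * 10 ^ 15 = thetaApprox + d :=
    ⟨theta * 10 ^ 15 - thetaApprox, by ring⟩
  have hd0 : 0 ≤ d := by linarith
  have hd1 : d ≤ 1 := by linarith
  have e : x.val * 10 ^ 30 - (x.approx : ℝ) =
      x.b * (d * 10 ^ 15) + x.c * ((2 * thetaApprox + d) * d) := by
    simp only [val, approx]
    push_cast
    have : theta ^ 2 * 10 ^ 30 = (thetaApprox + d) ^ 2 := by rw [← hd]; ring
    linear_combination (x.b * 10 ^ 15 : ℝ) * hd + (x.c : ℝ) * this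
  rw [e]
  have e1 : |(x.b : ℝ) * (d * 10 ^ 15)| ≤ |(x.b : ℝ)| * 10 ^ 15 := by
    rw [abs_mul]
    refine mul_le_mul_of_nonneg_left ?_ (abs_nonneg _)
    rw [abs_of_nonneg (by positivity)]
    linarith
  have e2 : |(x.c : ℝ) * ((2 * thetaApprox + d) * d)| ≤ |(x.c : ℝ)| * (4 * 10 ^ 15) := by
    rw [abs_mul]
    refine mul_le_mul_of_nonneg_left ?_ (abs_nonneg _)
    rw [abs_of_nonneg (by positivity)]
    nlinarith
  refine (abs_add_le _ _).trans ((add_le_add e1 e2).trans_eq ?_)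
  simp only [err]
  push_cast
  ring

end CubicInt

/-! ### Noncommutative polynomials in three unitaries of order three -/

/-- A noncommutative polynomial in the letters `y₀, y₁, y₂` with coefficients in `ℤ[θ]`, as a prefix
tree: `node c p q r` stands for `c + y₀ p + y₁ q + y₂ r`. -/
inductive NCPoly where
  | zero : NCPoly
  | node : CubicInt → NCPoly → NCPoly → NCPoly → NCPoly

namespace NCPoly

protected def add : NCPoly → NCPoly → NCPoly
  | zero, s => s
  | node c p q r, zero => node c p q r
  | node c p q r, node c' p' q' r' => node (c.add c') (p.add p') (q.add q') (r.add r')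

def smul (a : CubicInt) : NCPoly → NCPoly
  | zero => zero
  | node c p q r => node (a.mul c) (smul a p) (smul a q) (smul a r)

def const (n : CubicInt) : NCPoly := node n zero zero zero

/-- The product `y_l p`, without reduction. -/
def cons : Fin 3 → NCPoly → NCPoly
  | 0, p => node (.ofInt 0) p zero zero
  | 1, p => node (.ofInt 0) zero p zero
  | 2, p => node (.ofInt 0) zero zero p

/-- The polynomial `p'` for which `y_l p'` collects the monomials of `p` that begin with `y_l`. -/
def child : Fin 3 → NCPoly → NCPoly
  | _, zero => zero
  | 0, node _ p _ _ => p
  | 1, node _ _ q _ => q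
  | 2, node _ _ _ r => r

/-- The monomials of `p` that do not begin with `y_l`. -/
def erase : Fin 3 → NCPoly → NCPoly
  | _, zero => zero
  | 0, node c _ q r => node c zero q r
  | 1, node c p _ r => node c p zero r
  | 2, node c p q _ => node c p q zero

/-- The product `y_l p`, reduced by `y_l³ = 1`. -/
def leftMul (l : Fin 3) (p : NCPoly) : NCPoly :=
  (cons l ((erase l p).add (cons l (erase l (child l p))))).add (child l (child l p))

/-- The product `p* q`, where `y_l* = y_l²`. -/
def starMul : NCPoly → NCPoly → NCPoly
  | zero, _ => zero
  | node c p₀ p₁ p₂, s =>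
    (smul c s).add ((starMul p₀ (leftMul 0 (leftMul 0 s))).add
      ((starMul p₁ (leftMul 1 (leftMul 1 s))).add (starMul p₂ (leftMul 2 (leftMul 2 s)))))

/-- The substitution `y_l ↦ y_{σ l}`. -/
def rename (σ : Fin 3 → Fin 3) : NCPoly → NCPoly
  | zero => zero
  | node c p q r => (const c).add
      ((cons (σ 0) (rename σ p)).add ((cons (σ 1) (rename σ q)).add (cons (σ 2) (rename σ r))))

/-- The monomial with the given letters. -/
def mono : List (Fin 3) → NCPoly
  | [] => const (.ofInt 1)
  | l :: w => cons l (mono w)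

section Eval

variable {A : Type*} [Ring A] [Algebra ℂ A]

/-- The value of a noncommutative polynomial at a triple of elements of an algebra. -/
def eval (y : Fin 3 → A) : NCPoly → A
  | zero => 0
  | node c p q r => algebraMap ℂ A c.val + (y 0 * eval y p + y 1 * eval y q + y 2 * eval y r)

variable (y : Fin 3 → A)

theorem eval_add (p q : NCPoly) : eval y (p.add q) = eval y p + eval y q := by
  induction p generalizing q with
  | zero => simp [NCPoly.add, eval]
  | node c p₀ p₁ p₂ h₀ h₁ h₂ =>
    cases q with
    | zero => simp [NCPoly.add, eval]
    | node c' q₀ q₁ q₂ =>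
      simp only [NCPoly.add, eval, h₀, h₁, h₂, CubicInt.val_add, Complex.ofReal_add, map_add,
        mul_add]
      abel

theorem eval_smul (a : CubicInt) (p : NCPoly) :
    eval y (p.smul a) = algebraMap ℂ A a.val * eval y p := by
  induction p with
  | zero => simp [smul, eval]
  | node c p₀ p₁ p₂ h₀ h₁ h₂ =>
    have hc : ∀ (l : Fin 3) (z : A), y l * (algebraMap ℂ A a.val * z) =
        algebraMap ℂ A a.val * (y l * z) := fun l z => by
      rw [← mul_assoc, ← Algebra.commutes, mul_assoc]
    simp only [smul, eval, h₀, h₁, h₂, CubicInt.val_mul, Complex.ofReal_mul, map_mul, mul_add, hc]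

theorem eval_const (c : CubicInt) : eval y (const c) = algebraMap ℂ A c.val := by
  simp [const, eval]

theorem eval_cons (l : Fin 3) (p : NCPoly) : eval y (cons l p) = y l * eval y p := by
  fin_cases l <;> simp [cons, eval, CubicInt.val_ofInt]

theorem eval_erase_add_child (l : Fin 3) (p : NCPoly) :
    eval y (erase l p) + y l * eval y (child l p) = eval y p := by
  cases p with
  | zero => fin_cases l <;> simp [erase, child, eval]
  | node c p q r => fin_cases l <;> simp [erase, child, eval] <;> abel

theorem eval_leftMul (hy : ∀ l, y l ^ 3 = 1) (l : Fin 3) (p : NCPoly) :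
    eval y (leftMul l p) = y l * eval y p := by
  have h1 := eval_erase_add_child y l p
  have h2 := eval_erase_add_child y l (child l p)
  have h3 : y l * (y l * (y l * eval y (child l (child l p)))) =
      eval y (child l (child l p)) := by
    rw [← mul_assoc, ← mul_assoc, ← pow_two, ← pow_succ, hy, one_mul]
  rw [leftMul, eval_add, eval_cons, eval_add, eval_cons]
  conv_rhs => rw [← h1, ← h2]
  simp only [mul_add, h3]
  abel

theorem eval_rename (σ : Fin 3 → Fin 3) (p : NCPoly) :
    eval y (rename σ p) = eval (y ∘ σ) p := by
  induction p with
  | zero => rfl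
  | node c p₀ p₁ p₂ h₀ h₁ h₂ =>
    simp only [rename, eval_add, eval_const, eval_cons, h₀, h₁, h₂, eval, Function.comp]
    abel

theorem eval_mono (w : List (Fin 3)) : eval y (mono w) = (w.map y).prod := by
  induction w with
  | nil => simp [mono, eval_const, CubicInt.val_ofInt]
  | cons l w ih => simp [mono, eval_cons, ih]

theorem eval_starMul [StarRing A] [StarModule ℂ A] (hy : ∀ l, y l ^ 3 = 1)
    (hy' : ∀ l, star (y l) = y l * y l) (p q : NCPoly) :
    eval y (starMul p q) = star (eval y p) * eval y q := by
  induction p generalizing q with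
  | zero => simp [starMul, eval]
  | node c p₀ p₁ p₂ h₀ h₁ h₂ =>
    have hs : star (algebraMap ℂ A c.val) = algebraMap ℂ A c.val := by
      rw [← algebraMap_star_comm]; simp
    simp only [starMul, eval_add, eval_smul, h₀, h₁, h₂, eval_leftMul y hy, eval, star_add,
      star_mul, hs, hy', add_mul, mul_assoc]
    abel

/-- Linear maps intertwining two triples of operators intertwine the values of polynomials. -/
theorem eval_intertwine {V W : Type*} [AddCommGroup V] [Module ℂ V] [AddCommGroup W] [Module ℂ W]
    (f : V →ₗ[ℂ] W) {y : Fin 3 → Module.End ℂ V} {y' : Fin 3 → Module.End ℂ W}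
    (h : ∀ l v, f (y l v) = y' l (f v)) (p : NCPoly) (v : V) :
    f (eval y p v) = eval y' p (f v) := by
  induction p with
  | zero => simp [eval]
  | node c p₀ p₁ p₂ h₀ h₁ h₂ =>
    simp [eval, h, h₀, h₁, h₂, Module.algebraMap_end_apply]

end Eval

end NCPoly

/-! ### The sum-of-squares certificate -/

namespace NCPoly

/-- The sum of the three cyclic shifts of a monomial. -/
def rot (w : List (Fin 3)) : NCPoly :=
  (mono w).add ((mono (w.map (· + 1))).add (mono (w.map (· + 2))))

/-- The sum of the six images of a monomial under `S₃`. -/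
def sym (w : List (Fin 3)) : NCPoly := (rot w).add (rot (w.map (- ·)))

/-- The signed sum of the six images of a monomial under `S₃`. -/
def alt (w : List (Fin 3)) : NCPoly := (rot w).add (smul (.ofInt (-1)) (rot (w.map (- ·))))

/-- The `j`-th shift of a monomial plus its mirror image under the transposition `(1 2)`. -/
def pair (j : Fin 3) (w : List (Fin 3)) : NCPoly :=
  (mono (w.map (· + j))).add (mono (w.map (-(· + j))))

/-- The difference of the `j`-th and the zeroth shift, made symmetric under `(1 2)`. -/
def diff (j : Fin 3) (w : List (Fin 3)) : NCPoly :=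
  (pair j w).add (smul (.ofInt (-1)) (pair 0 w))

/-- Twice a monomial in the letter `y₀` minus its other two shifts. -/
def single (w : List (Fin 3)) : NCPoly :=
  (smul (.ofInt 3) (mono w)).add (smul (.ofInt (-1)) (rot w))

/-- Linear combinations. -/
def lin : List (CubicInt × NCPoly) → NCPoly
  | [] => zero
  | (c, p) :: s => (smul c p).add (lin s)

/-- The sum `p 0 + ⋯ + p (n - 1)`. -/
def sum (n : ℕ) (p : ℕ → NCPoly) : NCPoly := (List.range n).foldr (fun i s => (p i).add s) zero

end NCPoly

open NCPoly

/-- A Gram block of a sum-of-squares certificate: polynomials `n₀, n₁, …`, the rows (from the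
diagonal on) of a symmetric matrix over `ℤ[θ]`, and the rows (up to the diagonal) of a lower
triangular integer matrix `V` for which `V Vᵀ` is close to `100` times the Gram matrix. -/
structure Block where
  basis : List NCPoly
  gram : List (List CubicInt)
  root : List (List ℤ)

namespace Block

def size (B : Block) : ℕ := B.basis.length

def vec (B : Block) (i : ℕ) : NCPoly := B.basis.getD i zero

/-- The entries of the Gram matrix. -/
def entry (B : Block) (i j : ℕ) : CubicInt :=
  (B.gram.getD (min i j) []).getD (max i j - min i j) ⟨0, 0, 0⟩

def rootEntry (B : Block) (i j : ℕ) : ℤ := (B.root.getD i []).getD j 0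

/-- The polynomial `∑ᵢⱼ Gᵢⱼ nᵢ* nⱼ`. -/
def poly (B : Block) : NCPoly :=
  NCPoly.sum B.size fun i => starMul (B.vec i)
    (NCPoly.sum B.size fun j => smul (B.entry i j) (B.vec j))

/-- The entries of `100 G - V Vᵀ`. -/
def residual (B : Block) (i j : ℕ) : CubicInt :=
  ((CubicInt.ofInt 100).mul (B.entry i j)).add (CubicInt.ofInt (-((List.range B.size).foldr
    (fun k s => B.rootEntry i k * B.rootEntry j k + s) 0)))

/-- A decidable condition which ensures that the `i`-th diagonal entry of `100 G - V Vᵀ` exceeds the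
sum of the absolute values of the other entries of its row by at least one. -/
def RowDominant (B : Block) (i : ℕ) : Prop :=
  (List.range B.size).foldr (fun j s => (if j = i then 0 else
      |(B.residual i j).approx| + (B.residual i j).err) + s)
    (1000000000000000 * 1000000000000000) ≤ (B.residual i i).approx - (B.residual i i).err

instance (B : Block) (i : ℕ) : Decidable (B.RowDominant i) := by
  unfold RowDominant; infer_instance

end Block

/-- The symmetric block of the certificate. -/
def trivBlock : Block where
  basis :=
    [lin [(⟨2, -2, -1⟩, mono []), (⟨1, 0, 0⟩, rot [0]), (⟨1, 0, 0⟩, rot [0, 0])],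
     lin [(⟨1, 0, 0⟩, sym [1, 2, 2])],
     lin [(⟨1, 0, 0⟩, sym [1, 1, 2])],
     lin [(⟨1, 2, 1⟩, mono []), (⟨1, -2, -1⟩, rot [0]), (⟨1, 0, 0⟩, sym [1, 2])],
     lin [(⟨3, -3, -3⟩, mono []), (⟨-1, 2, 1⟩, rot [0]), (⟨1, 0, 0⟩, sym [1, 1, 2, 2])],
     lin [(⟨-3, 6, 3⟩, mono []), (⟨3, -3, -3⟩, rot [0]), (⟨1, 0, 0⟩, sym [0, 1, 2])],
     lin [(⟨1, -4, -2⟩, mono []), (⟨0, 2, 1⟩, rot [0]), (⟨1, 0, 0⟩, sym [0, 1, 1, 2, 2])],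
     lin [(⟨1, 0, 0⟩, sym [0, 0, 1, 1, 0, 0])]]
  gram :=
    [[⟨242101506, 334028286, -34804428⟩, ⟨-341127543, 2536368816, -1508853279⟩,
      ⟨-117464256, 0, 0⟩, ⟨75967632, 0, 0⟩, ⟨-1623610113, -1022150316, 1351908363⟩,
      ⟨-250247649, 428192394, -162867255⟩, ⟨1045911402, 448522086, -750866112⟩,
      ⟨10083528, -1271376, -13578840⟩],
     [⟨356056074, -81996948, -96147324⟩, ⟨34506, 0, 0⟩, ⟨3763098, 0, 0⟩,
      ⟨32062878, 55885869, -53209710⟩, ⟨-216170650, 1807476388, -1088670193⟩,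
      ⟨9915858, -2429757, -2041929⟩, ⟨2429028, 0, 0⟩],
     [⟨-589069434, -242642454, 430506252⟩, ⟨-9119061, 0, 0⟩, ⟨114295293, -5775624, -49147236⟩,
      ⟨-218605311, -6697404, 91970802⟩, ⟨165483, -450522, -450522⟩,
      ⟨100911906, 46245816, -67359600⟩],
     [⟨47066670, -2473011, -10051209⟩, ⟨24850638, -4792203, -12468330⟩, ⟨2824146, 0, 0⟩,
      ⟨1375623, 0, 0⟩, ⟨-1245132, 0, 0⟩],
     [⟨538956759, 801184341, -741436242⟩, ⟨21436488, -3761154, -2980395⟩, ⟨-3593241, 0, 0⟩,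
      ⟨-8056908, 2334258, -2334258⟩],
     [⟨7051860, 0, 0⟩, ⟨-598161198, 500268867, -71328183⟩, ⟨619062138, 576080076, -642644604⟩],
     [⟨-449342247, -788505330, 709105578⟩, ⟨0, 0, 0⟩],
     [⟨7109694, 0, 0⟩]]
  root :=
    [[259254],
     [1192, 21485],
     [-45309, 2673, 53846],
     [29302, 15890, 6932, 28437],
     [-6289, -33228, -22059, -10923, 29276],
     [9058, -11616, -15914, 10968, 10506, 2031],
     [-11347, 7147, -12842, 15667, -10430, 2887, 403],
     [-9156, 11814, 17062, -5704, -11851, -1070, -920, 3189]]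

/-- The antisymmetric block of the certificate. -/
def signBlock : Block where
  basis :=
    [lin [(⟨1, 0, 0⟩, alt [1, 2, 2])],
     lin [(⟨1, 0, 0⟩, alt [1, 1, 2])],
     lin [(⟨-4, 0, 1⟩, alt [1, 2]), (⟨5, 0, -2⟩, alt [1, 1, 2, 2]), (⟨1, 0, 0⟩, alt [0, 1, 2])],
     lin [(⟨-2, 0, 1⟩, alt [1, 2]), (⟨3, -1, -1⟩, alt [1, 1, 2, 2]),
           (⟨1, 0, 0⟩, alt [0, 1, 1, 2, 2])],
     lin [(⟨1, 0, 0⟩, alt [0, 0, 1, 1, 0, 0])]]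
  gram :=
    [[⟨33708474, 0, 0⟩, ⟨-243357858, -27831438, 119155698⟩, ⟨24422634, 14370129, -18956997⟩,
      ⟨-7240914, -492075, 1691037⟩, ⟨-3379968, -3080592, 2960064⟩],
     [⟨2307042, 0, 0⟩, ⟨14053014, 8253657, -11823327⟩, ⟨-766179, 589518, 188568⟩, ⟨410670, 0, 0⟩],
     [⟨1316088, 0, 0⟩, ⟨1357398, -200475, -385641⟩, ⟨-259362, 259362, -259362⟩],
     [⟨-2915271, 586116, 1172232⟩, ⟨0, 0, 0⟩],
     [⟨413910, 0, 0⟩]]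
  root :=
    [[57962],
     [-10877, 10055],
     [3349, -6865, 8385],
     [-6945, -1748, 3073, 2594],
     [-1987, 1935, -3237, -181, 3448]]

/-- The block of the certificate for the two-dimensional representation of `S₃`. -/
def stdBlock : Block where
  basis :=
    [lin [(⟨3, -1, -1⟩, single [0]), (⟨-3, 0, 1⟩, diff 1 [1, 2, 2]),
           (⟨1, 0, 0⟩, diff 2 [1, 2, 2])],
     lin [(⟨3, -1, -1⟩, single [0, 0]), (⟨-3, 0, 1⟩, diff 1 [1, 1, 2]),
           (⟨1, 0, 0⟩, diff 2 [1, 1, 2])],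
     lin [(⟨4, 0, -1⟩, single [0]), (⟨5, 0, -2⟩, single [0, 0]), (⟨-5, 0, 2⟩, diff 1 [1, 2, 2]),
           (⟨-6, 2, 2⟩, diff 1 [1, 1, 2]), (⟨3, 0, 0⟩, diff 1 [1, 2])],
     lin [(⟨-4, 0, 1⟩, single [0]), (⟨4, 0, -1⟩, single [0, 0]), (⟨5, 0, -2⟩, diff 1 [1, 2, 2]),
           (⟨-3, 1, 1⟩, diff 1 [1, 1, 2]), (⟨3, 0, 0⟩, diff 2 [1, 2])],
     lin [(⟨5, 0, -2⟩, single [0]), (⟨4, 0, -1⟩, single [0, 0]), (⟨-6, 2, 2⟩, diff 1 [1, 2, 2]),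
           (⟨-5, 0, 2⟩, diff 1 [1, 1, 2]), (⟨3, 0, 0⟩, diff 1 [1, 1, 2, 2])],
     lin [(⟨4, 0, -1⟩, single [0]), (⟨-4, 0, 1⟩, single [0, 0]), (⟨-3, 1, 1⟩, diff 1 [1, 2, 2]),
           (⟨5, 0, -2⟩, diff 1 [1, 1, 2]), (⟨3, 0, 0⟩, diff 2 [1, 1, 2, 2])],
     lin [(⟨1, 0, 0⟩, diff 1 [0, 1, 2])],
     lin [(⟨1, 0, 0⟩, diff 2 [0, 1, 2])],
     lin [(⟨-5, 0, 2⟩, single [0]), (⟨-1, 0, 1⟩, single [0, 0]), (⟨4, 0, -1⟩, diff 1 [1, 2, 2]),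
           (⟨3, -1, -1⟩, diff 1 [1, 1, 2]), (⟨3, 0, 0⟩, diff 1 [0, 1, 1, 2, 2])],
     lin [(⟨5, 0, -2⟩, single [0]), (⟨-5, 0, 2⟩, single [0, 0]), (⟨-4, 0, 1⟩, diff 1 [1, 2, 2]),
           (⟨6, -2, -2⟩, diff 1 [1, 1, 2]), (⟨3, 0, 0⟩, diff 2 [0, 1, 1, 2, 2])],
     lin [(⟨3, -1, -1⟩, single [0]), (⟨-3, 0, 1⟩, diff 1 [1, 2, 2]),
           (⟨-1, 0, 0⟩, diff 1 [1, 1, 2]), (⟨1, 0, 0⟩, diff 1 [0, 0, 1, 1, 0, 0])],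
     lin [(⟨3, -1, -1⟩, single [0]), (⟨-3, 1, 1⟩, single [0, 0]),
           (⟨-2, 0, 1⟩, diff 1 [1, 2, 2]), (⟨2, 0, -1⟩, diff 1 [1, 1, 2]),
           (⟨1, 0, 0⟩, diff 2 [0, 0, 1, 1, 0, 0])]]
  gram :=
    [[⟨131427036, 0, 0⟩, ⟨344412, 122180076, -70853616⟩, ⟨-2508732, 0, 0⟩,
      ⟨45765162, -7522308, -5960790⟩, ⟨12834774, 0, 0⟩, ⟨4662198, 37257246, -35473140⟩,
      ⟨270160122, -267625134, 61914930⟩, ⟨-16224138, 0, 0⟩, ⟨-6610572, 1619838, 1361286⟩,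
      ⟨-6610572, 1619838, 1361286⟩, ⟨-29362176, 12178674, 3308202⟩, ⟨-1995030, 0, 0⟩],
     [⟨495120912, -716655738, 338582754⟩, ⟨6079374, 0, 0⟩, ⟨-7975746, 0, 0⟩,
      ⟨-75831876, 3850416, 32764824⟩, ⟨84906306, -39423996, -17125020⟩,
      ⟨-150757050, -739334928, 562134480⟩, ⟨-897921798, 291673710, 204038040⟩,
      ⟨-110322, 300348, 300348⟩, ⟨-110322, 300348, 300348⟩, ⟨-157645440, 36628524, 33426432⟩,
      ⟨184395528, -165538242, 15082362⟩],
     [⟨8057394, 0, 0⟩, ⟨-7626312, 0, 0⟩, ⟨-765936, 0, 0⟩, ⟨2763396, 0, 0⟩,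
      ⟨8720055, -185166, -2287845⟩, ⟨-6837291, 185166, 2287845⟩, ⟨804816, 0, 0⟩, ⟨1796256, 0, 0⟩,
      ⟨-1254852, 0, 0⟩, ⟨424764, 0, 0⟩],
     [⟨11322828, 0, 0⟩, ⟨2641896, 0, 0⟩, ⟨-6897312, 0, 0⟩, ⟨-1882764, 0, 0⟩, ⟨-1882764, 0, 0⟩,
      ⟨-1944000, 0, 0⟩, ⟨-962766, 0, 0⟩, ⟨-201690, 0, 0⟩, ⟨-263412, 0, 0⟩],
     [⟨5108832, 0, 0⟩, ⟨-9660708, 0, 0⟩, ⟨-4014522, -667602, 2795634⟩,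
      ⟨16180236, -1839834, -4782564⟩, ⟨382968, 0, 0⟩, ⟨-78732, 0, 0⟩,
      ⟨-1725300, 1556172, -1556172⟩, ⟨-3645972, 0, 0⟩],
     [⟨20426580, 0, 0⟩, ⟨-13259214, 2507436, 1986930⟩, ⟨-13197492, 2507436, 1986930⟩,
      ⟨277506, 0, 0⟩, ⟨216756, 0, 0⟩, ⟨6934248, -1556172, 1556172⟩, ⟨7116498, -1556172, 1556172⟩],
     [⟨11000124, 0, 0⟩, ⟨3103596, 0, 0⟩, ⟨-198029668, 166555814, -24161702⟩,
      ⟨-200744464, 166956764, -23390420⟩, ⟨-8059824, 0, 0⟩, ⟨-6647022, 0, 0⟩],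
     [⟨11000124, 0, 0⟩, ⟨-200744464, 166956764, -23390420⟩, ⟨-198029668, 166555814, -24161702⟩,
      ⟨322167468, -265118832, 34437462⟩, ⟨-7218072, 0, 0⟩],
     [⟨1569780, 0, 0⟩, ⟨-732402, 0, 0⟩, ⟨0, 0, 0⟩, ⟨0, 0, 0⟩],
     [⟨1311228, 0, 0⟩, ⟨0, 0, 0⟩, ⟨0, 0, 0⟩],
     [⟨8032122, 0, 0⟩, ⟨6208164, 0, 0⟩],
     [⟨8330526, 0, 0⟩]]
  root :=
    [[114603],
     [18517, 137251],
     [-2189, 4725, 27885],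
     [17668, -8195, -24573, 12172],
     [11199, 3572, -2473, 2861, 18904],
     [-18780, -8900, 9943, -15322, -34677, 8585],
     [4771, 25595, 7033, 9037, -44, -10596, 12719],
     [-14157, 22227, -9121, 1632, 14043, 7620, -4737, 5003],
     [-815, 878, 2673, -8800, 4024, -188, 6581, -364, 3191],
     [-815, 878, 6229, 6439, -260, 4882, -4283, 959, -1306, 1852],
     [-2564, -16460, -1913, -12878, -9510, 13697, -7699, 1503, -1186, 1021, 3081],
     [-1741, -24407, 5522, -4921, -12177, 4199, 1406, 22, 782, 364, -46, 2497]]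

/-- The six permutations of the letters. -/
def perms : List (Fin 3 → Fin 3) :=
  [fun l => l, fun l => l + 1, fun l => l + 2, fun l => -l, fun l => 1 - l, fun l => 2 - l]

/-- The normalization of the certificate. -/
def certScale : ℤ := 24300000000

/-- The sum of squares `∑_σ ∑ᵢⱼ Gᵢⱼ (σ nᵢ)* (σ nⱼ)`, over all permutations `σ` of the letters and
all three blocks. -/
def certPoly : NCPoly :=
  perms.foldr (fun σ s => (rename σ
    (trivBlock.poly.add (signBlock.poly.add stdBlock.poly))).add s) zero

/-- `certScale` times `∑_l (y_l + y_l²) - τ`, where `τ = θ² + 2θ - 2`. -/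
def negTarget : NCPoly :=
  smul (.ofInt certScale) (lin [(⟨2, -2, -1⟩, mono []), (⟨1, 0, 0⟩, rot [0]),
    (⟨1, 0, 0⟩, rot [0, 0])])

/-- The letter `y_l` has degree one and weight `l + 1`. A polynomial is off-balance if, after
adding `d` to all degrees and `w` to all weights, each of its monomials has degree zero and nonzero
weight modulo three. -/
def NCPoly.offBalance : ℕ → ℕ → NCPoly → Bool
  | _, _, zero => true
  | d, w, node c p q r => (c.isZero || (d % 3 == 0 && w % 3 != 0)) &&
      (offBalance (d + 1) (w + 1) p && (offBalance (d + 1) (w + 2) q &&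
        offBalance (d + 1) (w + 3) r))

theorem trivBlock_dominant : ∀ i < 8, trivBlock.RowDominant i := by decide +kernel
theorem signBlock_dominant : ∀ i < 5, signBlock.RowDominant i := by decide +kernel
theorem stdBlock_dominant : ∀ i < 12, stdBlock.RowDominant i := by decide +kernel

theorem offBalance_certPoly : offBalance 0 0 (certPoly.add negTarget) = true := by
  decide +kernel

/-! ### Positivity of the certificate -/

theorem foldr_add_eq {M : Type*} [AddCommMonoid M] (L : List ℕ) (f : ℕ → M) (z : M) :
    L.foldr (fun i s => f i + s) z = L.foldr (fun i s => f i + s) 0 + z := by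
  induction L with
  | nil => simp
  | cons a L ih => simp [ih, add_assoc]

theorem foldr_range_eq_sum {M : Type*} [AddCommMonoid M] (n : ℕ) (f : ℕ → M) :
    (List.range n).foldr (fun i s => f i + s) 0 = ∑ i ∈ Finset.range n, f i := by
  induction n with
  | zero => simp
  | succ n ih =>
    rw [List.range_succ, List.foldr_append, foldr_add_eq, ih, Finset.sum_range_succ]; simp

namespace NCPoly

variable {A : Type*} [Ring A] [Algebra ℂ A] (y : Fin 3 → A)

theorem eval_sum (n : ℕ) (p : ℕ → NCPoly) :
    eval y (NCPoly.sum n p) = ∑ i ∈ Finset.range n, eval y (p i) := by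
  rw [← foldr_range_eq_sum, NCPoly.sum]
  induction List.range n with
  | nil => simp [eval]
  | cons a L ih => simp [eval_add, ih]

end NCPoly

namespace Block

theorem entry_symm (B : Block) (i j : ℕ) : B.entry i j = B.entry j i := by
  simp only [entry, min_comm, max_comm]

theorem residual_symm (B : Block) (i j : ℕ) : B.residual i j = B.residual j i := by
  simp only [residual, B.entry_symm i j, mul_comm (B.rootEntry i _)]

theorem residual_val (B : Block) (i j : ℕ) : (B.residual i j).val =
    100 * (B.entry i j).val -
      ∑ k ∈ Finset.range B.size, (B.rootEntry i k : ℝ) * B.rootEntry j k := by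
  rw [residual, CubicInt.val_add, CubicInt.val_mul, CubicInt.val_ofInt, CubicInt.val_ofInt,
    foldr_range_eq_sum]
  push_cast
  ring

theorem eval_poly {A : Type*} [Ring A] [Algebra ℂ A] [StarRing A] [StarModule ℂ A] (B : Block)
    {y : Fin 3 → A} (hy : ∀ l, y l ^ 3 = 1) (hy' : ∀ l, star (y l) = y l * y l) :
    eval y B.poly = ∑ i ∈ Finset.range B.size, ∑ j ∈ Finset.range B.size,
      ((B.entry i j).val : ℂ) • (star (eval y (B.vec i)) * eval y (B.vec j)) := by
  simp only [poly, eval_sum, eval_starMul y hy hy', eval_smul, Finset.mul_sum,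
    ← Algebra.smul_def, mul_smul_comm]

theorem RowDominant.le {B : Block} {i : ℕ} (h : B.RowDominant i) :
    1 + ∑ j ∈ Finset.range B.size, (if j = i then 0 else |(B.residual i j).val|) ≤
      (B.residual i i).val := by
  rw [RowDominant, foldr_add_eq, foldr_range_eq_sum] at h
  have h1 := (abs_le.1 (CubicInt.abs_sub_approx_le (B.residual i i))).1
  have h2 : ∑ j ∈ Finset.range B.size, (if j = i then 0 else |(B.residual i j).val|) * 10 ^ 30 ≤
      ((∑ j ∈ Finset.range B.size, (if j = i then 0 else
        |(B.residual i j).approx| + (B.residual i j).err) : ℤ) : ℝ) := by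
    push_cast
    refine Finset.sum_le_sum fun j _ => ?_
    split_ifs
    · simp
    · have h3 := CubicInt.abs_sub_approx_le (B.residual i j)
      have h4 := abs_sub_abs_le_abs_sub ((B.residual i j).val * 10 ^ 30)
        ((B.residual i j).approx : ℝ)
      rw [abs_mul, abs_of_nonneg (by positivity : (0 : ℝ) ≤ 10 ^ 30)] at h4
      linarith
  rw [← Finset.sum_mul] at h2
  have h5 : ((_ : ℤ) : ℝ) ≤ ((_ : ℤ) : ℝ) := Int.cast_le.2 h
  push_cast at h5 h2
  have h6 : (1 + ∑ j ∈ Finset.range B.size, (if j = i then 0 else |(B.residual i j).val|)) *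
      (10 : ℝ) ^ 30 ≤ (B.residual i i).val * 10 ^ 30 := by
    rw [add_mul]
    norm_num at h1 h2 h5 ⊢
    linarith
  exact le_of_mul_le_mul_right h6 (by positivity)

end Block

section Gram

variable {E : Type*} [NormedAddCommGroup E] [InnerProductSpace ℂ E]

/-- The quadratic form of a strictly diagonally dominant matrix is positive definite. -/
theorem sum_sq_le_of_dominant (s : Finset ℕ) (r : ℕ → ℕ → ℝ) (hr : ∀ i j, r i j = r j i)
    (h : ∀ i ∈ s, 1 + ∑ j ∈ s, (if j = i then 0 else |r i j|) ≤ r i i) (u : ℕ → E) :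
    ∑ i ∈ s, ‖u i‖ ^ 2 ≤ ∑ i ∈ s, ∑ j ∈ s, r i j * (inner ℂ (u i) (u j)).re := by
  set a : ℕ → ℕ → ℝ := fun i j => if j = i then 0 else |r i j| with ha
  have ha' : ∀ i j, a i j = a j i := fun i j => by
    simp only [ha, hr i j, eq_comm (a := i)]
  have key : ∀ i j, (if j = i then r i i * ‖u i‖ ^ 2 else 0) - a i j * ‖u i‖ ^ 2 / 2
      - a i j * ‖u j‖ ^ 2 / 2 ≤ r i j * (inner ℂ (u i) (u j)).re := by
    intro i j
    by_cases hij : j = i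
    · subst hij
      simp [ha, inner_self_eq_norm_sq_to_K, ← Complex.ofReal_pow]
    · simp only [ha, hij, if_false]
      have h1 : |(inner ℂ (u i) (u j)).re| ≤ ‖u i‖ * ‖u j‖ :=
        (Complex.abs_re_le_norm _).trans (norm_inner_le_norm _ _)
      have h2 : |r i j * (inner ℂ (u i) (u j)).re| ≤ |r i j| * (‖u i‖ * ‖u j‖) := by
        rw [abs_mul]; exact mul_le_mul_of_nonneg_left h1 (abs_nonneg _)
      have h3 := (abs_le.1 h2).1
      nlinarith [mul_nonneg (abs_nonneg (r i j)) (sq_nonneg (‖u i‖ - ‖u j‖))]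
  have hsum : ∑ i ∈ s, ∑ j ∈ s, a i j * ‖u j‖ ^ 2 / 2 =
      ∑ i ∈ s, ∑ j ∈ s, a i j * ‖u i‖ ^ 2 / 2 := by
    rw [Finset.sum_comm]
    exact Finset.sum_congr rfl fun i _ => Finset.sum_congr rfl fun j _ => by rw [ha']
  calc ∑ i ∈ s, ‖u i‖ ^ 2
      ≤ ∑ i ∈ s, (r i i - ∑ j ∈ s, a i j) * ‖u i‖ ^ 2 := by
        refine Finset.sum_le_sum fun i hi => ?_
        have := h i hi
        nlinarith [sq_nonneg ‖u i‖]
    _ = ∑ i ∈ s, ∑ j ∈ s, ((if j = i then r i i * ‖u i‖ ^ 2 else 0) - a i j * ‖u i‖ ^ 2 / 2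
          - a i j * ‖u j‖ ^ 2 / 2) := by
        simp only [Finset.sum_sub_distrib]
        rw [hsum, ← Finset.sum_sub_distrib, ← Finset.sum_sub_distrib]
        refine Finset.sum_congr rfl fun i hi => ?_
        rw [Finset.sum_ite_eq' s i, if_pos hi, sub_mul, Finset.sum_mul, ← Finset.sum_div]
        ring
    _ ≤ _ := Finset.sum_le_sum fun i _ => Finset.sum_le_sum fun j _ => key i j

/-- The matrix `100 G - V Vᵀ` is strictly diagonally dominant and `V Vᵀ` is positive semidefinite,
so `100 G ≥ 1`. -/
theorem Block.sum_sq_le (B : Block) (hB : ∀ i < B.size, B.RowDominant i) (u : ℕ → E) :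
    ∑ i ∈ Finset.range B.size, ‖u i‖ ^ 2 ≤ 100 * ∑ i ∈ Finset.range B.size,
      ∑ j ∈ Finset.range B.size, (B.entry i j).val * (inner ℂ (u i) (u j)).re := by
  have h1 := sum_sq_le_of_dominant (Finset.range B.size) (fun i j => (B.residual i j).val)
    (fun i j => by rw [B.residual_symm]) (fun i hi => (hB i (Finset.mem_range.1 hi)).le) u
  have h2 : 0 ≤ ∑ i ∈ Finset.range B.size, ∑ j ∈ Finset.range B.size,
      (∑ k ∈ Finset.range B.size, (B.rootEntry i k : ℝ) * B.rootEntry j k) *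
        (inner ℂ (u i) (u j)).re := by
    have h3 : ∀ k, ‖∑ i ∈ Finset.range B.size, ((B.rootEntry i k : ℝ) : ℂ) • u i‖ ^ 2 =
        ∑ i ∈ Finset.range B.size, ∑ j ∈ Finset.range B.size,
          (B.rootEntry i k : ℝ) * B.rootEntry j k * (inner ℂ (u i) (u j)).re := by
      intro k
      rw [← inner_self_eq_norm_sq (𝕜 := ℂ), sum_inner, map_sum]
      refine Finset.sum_congr rfl fun i _ => ?_
      rw [inner_sum, map_sum]
      refine Finset.sum_congr rfl fun j _ => ?_
      rw [inner_smul_left, inner_smul_right, Complex.conj_ofReal, RCLike.re_eq_complex_re,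
        Complex.re_ofReal_mul, Complex.re_ofReal_mul, mul_assoc]
    have h4 : 0 ≤ ∑ k ∈ Finset.range B.size,
        ‖∑ i ∈ Finset.range B.size, ((B.rootEntry i k : ℝ) : ℂ) • u i‖ ^ 2 := by positivity
    simp only [h3] at h4
    rw [Finset.sum_comm] at h4
    refine h4.trans_eq (Finset.sum_congr rfl fun i _ => ?_)
    rw [Finset.sum_comm]
    simp only [Finset.sum_mul]
  refine h1.trans (le_of_le_of_eq (le_add_of_nonneg_right h2) ?_)
  simp only [Finset.mul_sum, ← Finset.sum_add_distrib, ← add_mul, B.residual_val]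
  refine Finset.sum_congr rfl fun i _ => Finset.sum_congr rfl fun j _ => ?_
  ring

end Gram

/-- The blocks of the certificate. -/
def blocks : List Block := [trivBlock, signBlock, stdBlock]

theorem blocks_dominant : ∀ B ∈ blocks, ∀ i < B.size, B.RowDominant i := by
  simp only [blocks, List.mem_cons, List.not_mem_nil, or_false]
  rintro B (rfl | rfl | rfl)
  exacts [trivBlock_dominant, signBlock_dominant, stdBlock_dominant]

section Hilbert

variable {E : Type*} [NormedAddCommGroup E] [InnerProductSpace ℂ E]

/-- The sum of the squared norms of the vectors `nᵢ(y_{σ 0}, y_{σ 1}, y_{σ 2}) v`, over all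
permutations `σ` and all polynomials `nᵢ` of the certificate. -/
def nullSum (y : Fin 3 → (E →L[ℂ] E)) (v : E) : ℝ :=
  (perms.map fun σ => (blocks.map fun B =>
    ∑ i ∈ Finset.range B.size, ‖eval (y ∘ σ) (B.vec i) v‖ ^ 2).sum).sum

theorem sq_norm_le_nullSum (y : Fin 3 → (E →L[ℂ] E)) (v : E) {σ : Fin 3 → Fin 3} (hσ : σ ∈ perms)
    {B : Block} (hB : B ∈ blocks) {i : ℕ} (hi : i < B.size) :
    ‖eval (y ∘ σ) (B.vec i) v‖ ^ 2 ≤ nullSum y v := by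
  have h1 : ‖eval (y ∘ σ) (B.vec i) v‖ ^ 2 ≤
      ∑ i ∈ Finset.range B.size, ‖eval (y ∘ σ) (B.vec i) v‖ ^ 2 :=
    Finset.single_le_sum (f := fun i => ‖eval (y ∘ σ) (B.vec i) v‖ ^ 2)
      (fun i _ => by positivity) (Finset.mem_range.2 hi)
  have h2 : ∀ τ, ∀ z ∈ blocks.map fun B =>
      ∑ i ∈ Finset.range B.size, ‖eval (y ∘ τ) (B.vec i) v‖ ^ 2, 0 ≤ z := by
    intro τ z hz
    obtain ⟨B, _, rfl⟩ := List.mem_map.1 hz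
    positivity
  refine h1.trans ((List.single_le_sum (h2 σ) _ (List.mem_map.2 ⟨B, hB, rfl⟩)).trans ?_)
  refine List.single_le_sum ?_ _ (List.mem_map.2 ⟨σ, hσ, rfl⟩)
  intro z hz
  obtain ⟨τ, _, rfl⟩ := List.mem_map.1 hz
  exact List.sum_nonneg (h2 τ)

theorem nullSum_nonneg (y : Fin 3 → (E →L[ℂ] E)) (v : E) : 0 ≤ nullSum y v :=
  (sq_nonneg _).trans (sq_norm_le_nullSum y v (σ := fun l => l) (by simp [perms])
    (B := trivBlock) (by simp [blocks]) (i := 0) (by simp [Block.size, trivBlock]))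

variable [CompleteSpace E]

theorem Block.sum_sq_le_re_inner (B : Block) (hB : ∀ i < B.size, B.RowDominant i)
    {y : Fin 3 → (E →L[ℂ] E)} (hy : ∀ l, y l ^ 3 = 1) (hy' : ∀ l, star (y l) = y l * y l) (v : E) :
    ∑ i ∈ Finset.range B.size, ‖eval y (B.vec i) v‖ ^ 2 ≤
      100 * (inner ℂ v (eval y B.poly v)).re := by
  refine (B.sum_sq_le hB fun i => eval y (B.vec i) v).trans_eq ?_
  rw [B.eval_poly hy hy']
  simp only [sum_apply, inner_sum, Complex.re_sum,
    smul_apply, inner_smul_right, mul_apply_eq_comp,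
    ContinuousLinearMap.star_eq_adjoint, ContinuousLinearMap.adjoint_inner_right,
    Complex.re_ofReal_mul]

theorem nullSum_le {y : Fin 3 → (E →L[ℂ] E)} (hy : ∀ l, y l ^ 3 = 1)
    (hy' : ∀ l, star (y l) = y l * y l) (v : E) :
    nullSum y v ≤ 100 * (inner ℂ v (eval y certPoly v)).re := by
  have h : ∀ L : List (Fin 3 → Fin 3), 100 * (inner ℂ v (eval y (L.foldr (fun σ s => (rename σ
      (trivBlock.poly.add (signBlock.poly.add stdBlock.poly))).add s) zero) v)).re =
      (L.map fun σ => (blocks.map fun B =>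
        100 * (inner ℂ v (eval (y ∘ σ) B.poly v)).re).sum).sum := by
    intro L
    induction L with
    | nil => simp [eval]
    | cons σ L ih =>
      rw [List.foldr_cons, eval_add, add_apply, inner_add_right,
        Complex.add_re, mul_add, ih, List.map_cons, List.sum_cons, eval_rename]
      simp only [blocks, eval_add, add_apply, inner_add_right, Complex.add_re,
        mul_add, List.map_cons, List.map_nil, List.sum_cons, List.sum_nil, add_zero]
  rw [certPoly, h]
  refine List.sum_le_sum fun σ _ => List.sum_le_sum fun B hB => ?_
  exact B.sum_sq_le_re_inner (blocks_dominant B hB) (fun l => hy _) (fun l => hy' _) v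

end Hilbert

/-! ### Twisting by the other party -/

theorem omega_cube : omega ^ 3 = 1 := by
  rw [omega, ← Complex.exp_nat_mul, Complex.exp_eq_one_iff]
  exact ⟨1, by push_cast; ring⟩

theorem isPrimitiveRoot_omega : IsPrimitiveRoot omega 3 := by
  have h := Complex.isPrimitiveRoot_exp 3 (by norm_num)
  norm_num at h
  exact h

theorem omega_sq_add : omega ^ 2 + omega + 1 = 0 := by
  have h := isPrimitiveRoot_omega.geom_sum_eq_zero (by norm_num)
  simp only [Finset.sum_range_succ, Finset.sum_range_zero] at h
  linear_combination h

theorem sum_omega_pow {w : ℕ} (hw : w % 3 ≠ 0) :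
    ∑ k : Fin 3, omega ^ (((k : ℕ) + 1) * w) = 0 := by
  have h3 := omega_cube
  have h := omega_sq_add
  have hr : ∀ m, omega ^ m = omega ^ (m % 3) := fun m => pow_eq_pow_mod m h3
  simp only [Fin.sum_univ_three, Fin.val_zero, Fin.val_one, Fin.val_two]
  rw [hr ((0 + 1) * w), hr ((1 + 1) * w), hr ((2 + 1) * w), Nat.mul_mod, Nat.mul_mod (1 + 1),
    Nat.mul_mod (2 + 1)]
  have : w % 3 = 1 ∨ w % 3 = 2 := by omega
  rcases this with h' | h' <;> rw [h'] <;> norm_num <;> linear_combination h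

section Algebra

variable {A : Type*} [Ring A] [Algebra ℂ A]

/-- The operators `ω^{kl} xₖ y_l`, `l = 1, 2, 3`, in terms of which the Bell polynomial is a sum
over `k` of one-sided expressions. -/
def twist (x y : Fin 3 → A) (k l : Fin 3) : A :=
  omega ^ (((k : ℕ) + 1) * ((l : ℕ) + 1)) • (x k * y l)

variable {x y : Fin 3 → A}

theorem twist_pow (hxy : ∀ i j, x i * y j = y j * x i) (k l : Fin 3) (n : ℕ) :
    twist x y k l ^ n = omega ^ (((k : ℕ) + 1) * ((l : ℕ) + 1) * n) • (x k ^ n * y l ^ n) := by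
  rw [twist, smul_pow, (show Commute (x k) (y l) from hxy k l).mul_pow, ← pow_mul]

theorem twist_cube (hx : ∀ i, x i ^ 3 = 1) (hy : ∀ i, y i ^ 3 = 1)
    (hxy : ∀ i j, x i * y j = y j * x i) (k l : Fin 3) : twist x y k l ^ 3 = 1 := by
  rw [twist_pow hxy, hx, hy, mul_comm _ 3, pow_mul, omega_cube, one_pow, one_smul, mul_one]

theorem chshPoly_eq_twist (hx : ∀ i, x i ^ 3 = 1) (hy : ∀ i, y i ^ 3 = 1)
    (hxy : ∀ i j, x i * y j = y j * x i) :
    (27 : ℂ) • chshPoly x y =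
      algebraMap ℂ A 9 + ∑ k, ∑ l, (twist x y k l + twist x y k l ^ 2) := by
  have h : ∀ k l, ∑ n ∈ Finset.Icc 1 3, omega ^ (((k : Fin 3) + 1 : ℕ) * ((l : Fin 3) + 1 : ℕ) * n)
      • (x k ^ n * y l ^ n) = 1 + (twist x y k l + twist x y k l ^ 2) := by
    intro k l
    simp only [← twist_pow hxy]
    rw [show Finset.Icc 1 3 = {1, 2, 3} from rfl, Finset.sum_insert (by simp),
      Finset.sum_insert (by simp), Finset.sum_singleton, twist_cube hx hy hxy, pow_one]
    abel
  simp only [chshPoly, h, Finset.sum_add_distrib]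
  rw [smul_smul]
  norm_num
  rw [← map_ofNat (algebraMap ℂ A) 9]

theorem chshPoly_swap (hxy : ∀ i j, x i * y j = y j * x i) : chshPoly y x = chshPoly x y := by
  unfold chshPoly
  rw [Finset.sum_comm]
  congr 1
  refine Finset.sum_congr rfl fun k _ => Finset.sum_congr rfl fun l _ =>
    Finset.sum_congr rfl fun n _ => ?_
  rw [mul_comm ((l : ℕ) + 1), (show Commute (x k) (y l) from hxy k l).pow_pow]

/-- Off-balance monomials cancel in the sum over `k`: evaluated at `ω^{kl} xₖ y_l`, a monomial of
degree `3 d` and weight `w` is `ω^{kw}` times a monomial in the `y_l`, which does not depend on `k`.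
-/
theorem sum_eval_twist_offBalance (hx : ∀ i, x i ^ 3 = 1) (hxy : ∀ i j, x i * y j = y j * x i)
    (p : NCPoly) (d w : ℕ) (hp : offBalance d w p = true) :
    ∑ k : Fin 3, omega ^ (((k : ℕ) + 1) * w) • (x k ^ d * eval (twist x y k) p) = 0 := by
  induction p generalizing d w with
  | zero => simp [eval]
  | node c p q r hp' hq' hr' =>
    simp only [offBalance, Bool.and_eq_true, Bool.or_eq_true, beq_iff_eq, bne_iff_ne] at hp
    obtain ⟨hc, h0, h1, h2⟩ := hp
    have e : ∀ (k l : Fin 3) (s : NCPoly),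
        omega ^ (((k : ℕ) + 1) * w) • (x k ^ d * (twist x y k l * eval (twist x y k) s)) =
        y l * (omega ^ (((k : ℕ) + 1) * (w + ((l : ℕ) + 1))) •
          (x k ^ (d + 1) * eval (twist x y k) s)) := by
      intro k l s
      have h3 : Commute (x k) (y l) := hxy k l
      rw [twist, smul_mul_assoc, mul_smul_comm, smul_smul, ← pow_add, ← mul_add, mul_smul_comm,
        pow_succ]
      congr 1
      rw [← mul_assoc, ← mul_assoc, ← mul_assoc, ← mul_assoc, mul_assoc (x k ^ d), h3.eq,
        ← mul_assoc, (h3.pow_left d).eq]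
    have hconst : ∑ k : Fin 3, omega ^ (((k : ℕ) + 1) * w) • (x k ^ d * algebraMap ℂ A c.val) =
        0 := by
      rcases hc with hc | ⟨hd, hw⟩
      · simp [CubicInt.val_eq_zero hc]
      · have hxd : ∀ k, x k ^ d = 1 := fun k => by rw [pow_eq_pow_mod d (hx k), hd, pow_zero]
        simp only [hxd, one_mul, ← Finset.sum_smul, sum_omega_pow hw, zero_smul]
    have g0 := hp' _ _ h0
    have g1 := hq' _ _ h1
    have g2 := hr' _ _ h2
    have hsum : ∀ k : Fin 3, omega ^ (((k : ℕ) + 1) * w) •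
        (x k ^ d * eval (twist x y k) (node c p q r)) =
        omega ^ (((k : ℕ) + 1) * w) • (x k ^ d * algebraMap ℂ A c.val) +
          (y 0 * (omega ^ (((k : ℕ) + 1) * (w + 1)) • (x k ^ (d + 1) * eval (twist x y k) p)) +
          y 1 * (omega ^ (((k : ℕ) + 1) * (w + 2)) • (x k ^ (d + 1) * eval (twist x y k) q)) +
          y 2 * (omega ^ (((k : ℕ) + 1) * (w + 3)) • (x k ^ (d + 1) * eval (twist x y k) r))) := by
      intro k
      rw [eval, mul_add, mul_add, mul_add, smul_add, smul_add, smul_add, e, e, e]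
      rfl
    simp only [hsum, Finset.sum_add_distrib, hconst, ← Finset.mul_sum, g0, g1, g2, mul_zero,
      add_zero]

end Algebra

/-- The number `τ = 2√3 cos (π/18)`. -/
def tau : ℝ := theta ^ 2 + 2 * theta - 2

/-- The number `1/3 + τ/9`, which is the maximal quantum value. -/
def beta : ℝ := (tau + 3) / 9

theorem eval_rot_zero {A : Type*} [Ring A] [Algebra ℂ A] (y : Fin 3 → A) :
    eval y (rot [0]) = ∑ l, y l := by
  simp [rot, eval_add, eval_mono, Fin.sum_univ_three, add_assoc]

theorem eval_rot_zero_zero {A : Type*} [Ring A] [Algebra ℂ A] (y : Fin 3 → A) :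
    eval y (rot [0, 0]) = ∑ l, y l ^ 2 := by
  simp [rot, eval_add, eval_mono, Fin.sum_univ_three, add_assoc, pow_two]

theorem eval_negTarget {A : Type*} [Ring A] [Algebra ℂ A] (y : Fin 3 → A) :
    eval y negTarget = (certScale : ℂ) • (∑ l, (y l + y l ^ 2) - algebraMap ℂ A tau) := by
  have h1 : (CubicInt.val ⟨1, 0, 0⟩ : ℝ) = 1 := by simp [CubicInt.val]
  have h2 : (CubicInt.val ⟨2, -2, -1⟩ : ℝ) = -tau := by
    simp only [CubicInt.val, tau]; push_cast; ring
  rw [negTarget, eval_smul, CubicInt.val_ofInt, ← Algebra.smul_def]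
  simp only [lin, eval_add, eval_smul, h1, h2, eval_rot_zero, eval_rot_zero_zero, eval,
    Finset.sum_add_distrib]
  simp [eval_mono, smul_add, smul_sub]
  abel

/-! ### The sum-of-squares bound -/

section Hilbert

variable {E : Type*} [NormedAddCommGroup E] [InnerProductSpace ℂ E] [CompleteSpace E]

theorem star_eq_mul_self {R : Type*} [Ring R] [StarRing R] {u : R} (hu : u ∈ unitary R)
    (h3 : u ^ 3 = 1) : star u = u * u := by
  have h := (Unitary.mem_iff.1 hu).1
  calc star u = star u * u ^ 3 := by rw [h3, mul_one]
    _ = (star u * u) * (u * u) := by rw [pow_succ, pow_two]; simp only [mul_assoc]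
    _ = u * u := by rw [h, one_mul]

theorem star_twist {x y : Fin 3 → (E →L[ℂ] E)} (h : IsFeasible x y) (k l : Fin 3) :
    star (twist x y k l) = twist x y k l * twist x y k l := by
  have ho : star omega = omega ^ 2 := by
    have h1 : ‖omega‖ = 1 := isPrimitiveRoot_omega.norm'_eq_one (by norm_num)
    have h2 : star omega * omega = 1 := by
      rw [Complex.star_def, Complex.conj_mul', h1]; simp
    calc star omega = star omega * omega ^ 3 := by rw [omega_cube, mul_one]
      _ = (star omega * omega) * omega ^ 2 := by ring
      _ = omega ^ 2 := by rw [h2, one_mul]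
  rw [← pow_two, twist_pow h.commute, twist, star_smul, star_mul, star_pow, ho,
    star_eq_mul_self (h.unitary_X k) (h.cube_X k), star_eq_mul_self (h.unitary_Y l) (h.cube_Y l),
    ← pow_mul, ← pow_two, ← pow_two, mul_comm 2,
    (show Commute (x k) (y l) from h.commute k l).pow_pow]

/-- The deficit of a strategy bounds the certificate at its state: the sum over `k` of the
evaluations of `certPoly` at `ω^{kl} xₖ y_l` is a multiple of `27 (β - p₃)`. -/
theorem sum_nullSum_le {x y : Fin 3 → (E →L[ℂ] E)} (h : IsFeasible x y) (v : E) :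
    ∑ k, nullSum (twist x y k) v ≤
      2700 * certScale * (beta * ‖v‖ ^ 2 - (inner ℂ v (chshPoly x y v)).re) := by
  have h1 : ∀ k, nullSum (twist x y k) v ≤
      100 * (inner ℂ v (eval (twist x y k) certPoly v)).re := fun k =>
    nullSum_le (twist_cube h.cube_X h.cube_Y h.commute k) (star_twist h k) v
  refine (Finset.sum_le_sum fun k _ => h1 k).trans_eq ?_
  have h2 : ∑ k, eval (twist x y k) certPoly = (certScale : ℂ) •
      (algebraMap ℂ (E →L[ℂ] E) (27 * beta : ℝ) - (27 : ℂ) • chshPoly x y) := by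
    have h3 := sum_eval_twist_offBalance h.cube_X h.commute _ 0 0 offBalance_certPoly
    simp only [mul_zero, pow_zero, one_smul, one_mul, eval_add, eval_negTarget,
      Finset.sum_add_distrib, ← Finset.smul_sum, Finset.sum_sub_distrib] at h3
    rw [eq_neg_of_add_eq_zero_left h3, chshPoly_eq_twist h.cube_X h.cube_Y h.commute, ← smul_neg]
    congr 1
    have h4 : (27 * beta : ℝ) = 9 + 3 * tau := by unfold beta; ring
    rw [h4, Complex.ofReal_add, Complex.ofReal_mul, Complex.ofReal_ofNat, Complex.ofReal_ofNat,
      map_add, map_mul, map_ofNat _ 3]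
    simp only [Finset.sum_const, Finset.card_univ, Fintype.card_fin, Finset.sum_add_distrib,
      nsmul_eq_mul]
    push_cast
    abel
  rw [← Finset.mul_sum, ← Complex.re_sum, ← inner_sum, ← sum_apply, h2]
  have h3 : ((certScale : ℂ) • (algebraMap ℂ (E →L[ℂ] E) (27 * beta : ℝ) -
      (27 : ℂ) • chshPoly x y)) v =
      ((certScale : ℝ) : ℂ) • (((27 * beta : ℝ) : ℂ) • v - ((27 : ℝ) : ℂ) • chshPoly x y v) := by
    rw [Complex.ofReal_intCast, Complex.ofReal_ofNat, Algebra.algebraMap_eq_smul_one]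
    rfl
  have h4 : (inner ℂ v v).re = ‖v‖ ^ 2 := inner_self_eq_norm_sq (𝕜 := ℂ) v
  rw [h3, inner_smul_right, inner_sub_right, inner_smul_right, inner_smul_right,
    Complex.re_ofReal_mul, Complex.sub_re, Complex.re_ofReal_mul, Complex.re_ofReal_mul, h4]
  ring

theorem re_inner_chshPoly_le {x y : Fin 3 → (E →L[ℂ] E)} (h : IsFeasible x y) (v : E) :
    (inner ℂ v (chshPoly x y v)).re ≤ beta * ‖v‖ ^ 2 := by
  have h1 := sum_nullSum_le h v
  have h2 : 0 ≤ ∑ k, nullSum (twist x y k) v := Finset.sum_nonneg fun k _ => nullSum_nonneg _ _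
  have h3 : (0 : ℝ) < certScale := by norm_num [certScale]
  have h4 := h2.trans h1
  have h5 : 0 ≤ beta * ‖v‖ ^ 2 - (inner ℂ v (chshPoly x y v)).re :=
    nonneg_of_mul_nonneg_right h4 (by positivity)
  linarith

end Hilbert

/-! ### Tensor product strategies -/

section Tensor

variable {m n : Type*} [Fintype m] [DecidableEq m] [Fintype n] [DecidableEq n]

/-- The operator `A ⊗ I` on `ℂᵐ ⊗ ℂⁿ`. -/
def opA (A : Matrix m m ℂ) : EuclideanSpace ℂ (m × n) →L[ℂ] EuclideanSpace ℂ (m × n) :=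
  Matrix.toEuclideanCLM (𝕜 := ℂ) (A ⊗ₖ (1 : Matrix n n ℂ))

/-- The operator `I ⊗ B` on `ℂᵐ ⊗ ℂⁿ`. -/
def opB (B : Matrix n n ℂ) : EuclideanSpace ℂ (m × n) →L[ℂ] EuclideanSpace ℂ (m × n) :=
  Matrix.toEuclideanCLM (𝕜 := ℂ) ((1 : Matrix m m ℂ) ⊗ₖ B)

theorem opA_mul (A A' : Matrix m m ℂ) : opA (n := n) (A * A') = opA A * opA A' := by
  rw [opA, opA, opA, ← map_mul, ← Matrix.mul_kronecker_mul, one_mul]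

theorem opB_mul (B B' : Matrix n n ℂ) : opB (m := m) (B * B') = opB B * opB B' := by
  rw [opB, opB, opB, ← map_mul, ← Matrix.mul_kronecker_mul, one_mul]

theorem opA_one : opA (n := n) (1 : Matrix m m ℂ) = 1 := by
  rw [opA, Matrix.one_kronecker_one, map_one]

theorem opB_one : opB (m := m) (1 : Matrix n n ℂ) = 1 := by
  rw [opB, Matrix.one_kronecker_one, map_one]

theorem opA_star (A : Matrix m m ℂ) : opA (n := n) (star A) = star (opA A) := by
  rw [opA, opA, ← map_star]
  simp only [Matrix.star_eq_conjTranspose, Matrix.conjTranspose_kronecker,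
    Matrix.conjTranspose_one]

theorem opB_star (B : Matrix n n ℂ) : opB (m := m) (star B) = star (opB B) := by
  rw [opB, opB, ← map_star]
  simp only [Matrix.star_eq_conjTranspose, Matrix.conjTranspose_kronecker,
    Matrix.conjTranspose_one]

theorem opA_mul_opB (A : Matrix m m ℂ) (B : Matrix n n ℂ) :
    opA A * opB B = opB B * opA A := by
  rw [opA, opB, ← map_mul, ← map_mul, ← Matrix.mul_kronecker_mul, ← Matrix.mul_kronecker_mul]
  simp

/-- `A ↦ A ⊗ I` as a homomorphism. -/
def opAHom : Matrix m m ℂ →* (EuclideanSpace ℂ (m × n) →L[ℂ] EuclideanSpace ℂ (m × n)) where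
  toFun := opA
  map_one' := opA_one
  map_mul' := opA_mul

/-- `B ↦ I ⊗ B` as a homomorphism. -/
def opBHom : Matrix n n ℂ →* (EuclideanSpace ℂ (m × n) →L[ℂ] EuclideanSpace ℂ (m × n)) where
  toFun := opB
  map_one' := opB_one
  map_mul' := opB_mul

theorem opA_mem_unitary {U : Matrix m m ℂ} (hU : U ∈ unitary (Matrix m m ℂ)) :
    opA (n := n) U ∈ unitary (EuclideanSpace ℂ (m × n) →L[ℂ] _) := by
  have h := Unitary.mem_iff.1 hU
  rw [Unitary.mem_iff, ← opA_star, ← opA_mul, ← opA_mul, h.1, h.2]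
  exact ⟨opA_one, opA_one⟩

theorem opB_mem_unitary {U : Matrix n n ℂ} (hU : U ∈ unitary (Matrix n n ℂ)) :
    opB (m := m) U ∈ unitary (EuclideanSpace ℂ (m × n) →L[ℂ] _) := by
  have h := Unitary.mem_iff.1 hU
  rw [Unitary.mem_iff, ← opB_star, ← opB_mul, ← opB_mul, h.1, h.2]
  exact ⟨opB_one, opB_one⟩

theorem isFeasible_op {X : Fin 3 → Matrix m m ℂ} {Y : Fin 3 → Matrix n n ℂ}
    (hX : ∀ i, X i ∈ unitary (Matrix m m ℂ)) (hY : ∀ i, Y i ∈ unitary (Matrix n n ℂ))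
    (hX3 : ∀ i, X i ^ 3 = 1) (hY3 : ∀ i, Y i ^ 3 = 1) :
    IsFeasible (fun i => opA (n := n) (X i)) (fun i => opB (m := m) (Y i)) where
  unitary_X i := opA_mem_unitary (hX i)
  unitary_Y i := opB_mem_unitary (hY i)
  cube_X i := by
    have h := map_pow (opAHom (n := n)) (X i) 3
    rw [hX3, map_one] at h
    exact h.symm
  cube_Y i := by
    have h := map_pow (opBHom (m := m)) (Y i) 3
    rw [hY3, map_one] at h
    exact h.symm
  commute i j := opA_mul_opB _ _

theorem map_chshPoly {A B : Type*} [Ring A] [Algebra ℂ A] [Ring B] [Algebra ℂ B] (F : A →ₐ[ℂ] B)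
    (x y : Fin 3 → A) : F (chshPoly x y) = chshPoly (fun i => F (x i)) (fun i => F (y i)) := by
  simp [chshPoly, map_sum]

theorem inner_toEuclideanCLM_eq (M : Matrix n n ℂ) (v w : EuclideanSpace ℂ n) :
    inner ℂ v (Matrix.toEuclideanCLM (𝕜 := ℂ) M w) = star (v : n → ℂ) ⬝ᵥ (M *ᵥ (w : n → ℂ)) := by
  rw [EuclideanSpace.inner_eq_star_dotProduct, Matrix.ofLp_toEuclideanCLM, dotProduct_comm]

theorem strategyValue_eq {nA nB : ℕ} (X : Fin 3 → Matrix (Fin nA) (Fin nA) ℂ)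
    (Y : Fin 3 → Matrix (Fin nB) (Fin nB) ℂ) (ψ : EuclideanSpace ℂ (Fin nA × Fin nB)) :
    strategyValue X Y ψ =
      (inner ℂ ψ (chshPoly (fun i => opA (X i)) (fun i => opB (Y i)) ψ)).re := by
  have h := map_chshPoly (Matrix.toEuclideanCLM (n := Fin nA × Fin nB) (𝕜 := ℂ) :
      Matrix (Fin nA × Fin nB) (Fin nA × Fin nB) ℂ ≃⋆ₐ[ℂ] _).toAlgEquiv.toAlgHom
    (fun i => X i ⊗ₖ (1 : Matrix (Fin nB) (Fin nB) ℂ))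
    (fun i => (1 : Matrix (Fin nA) (Fin nA) ℂ) ⊗ₖ Y i)
  rw [strategyValue, ← inner_toEuclideanCLM_eq]
  exact congrArg (fun T : EuclideanSpace ℂ (Fin nA × Fin nB) →L[ℂ] _ => (inner ℂ ψ (T ψ)).re) h

end Tensor

theorem bddAbove_quantumValues : BddAbove quantumValues := by
  refine ⟨beta, ?_⟩
  rintro v ⟨H, _, _, _, X, Y, ψ, h, hψ, rfl⟩
  have := re_inner_chshPoly_le h ψ
  rwa [hψ, one_pow, mul_one] at this

/-! ### A strategy attaining the maximal quantum value -/

/-- The weighted cyclic shift `eᵢ ↦ aᵢ eᵢ₊₁`. -/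
def weightedShift (a : Fin 3 → ℂ) : Matrix (Fin 3) (Fin 3) ℂ :=
  !![0, 0, a 2; a 0, 0, 0; 0, a 1, 0]

theorem weightedShift_cube {a : Fin 3 → ℂ} (h : a 0 * a 1 * a 2 = 1) : weightedShift a ^ 3 = 1 := by
  rw [weightedShift, pow_succ, pow_two, Matrix.mul_fin_three, Matrix.mul_fin_three,
    Matrix.one_fin_three]
  ext i j
  fin_cases i <;> fin_cases j <;> simp <;> linear_combination h

theorem weightedShift_mem_unitary {a : Fin 3 → ℂ} (h : ∀ i, ‖a i‖ = 1) :
    weightedShift a ∈ unitary (Matrix (Fin 3) (Fin 3) ℂ) := by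
  have h' : ∀ i, (starRingEnd ℂ) (a i) * a i = 1 := fun i => by
    rw [Complex.conj_mul', h]; simp
  change _ ∈ Matrix.unitaryGroup (Fin 3) ℂ
  rw [Matrix.mem_unitaryGroup_iff', Matrix.star_eq_conjTranspose]
  ext i j
  fin_cases i <;> fin_cases j <;>
    simp [Matrix.mul_apply, Fin.sum_univ_three, weightedShift, h']

/-- The ninth root of unity `exp(2πi/9)`. -/
def zeta : ℂ := Complex.exp (2 * Real.pi / 9 * Complex.I)

theorem zeta_cube : zeta ^ 3 = omega := by
  rw [zeta, omega, ← Complex.exp_nat_mul]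
  congr 1
  push_cast
  ring

theorem norm_zeta : ‖zeta‖ = 1 := by
  have h := Complex.norm_exp_ofReal_mul_I (2 * Real.pi / 9)
  push_cast at h
  exact h

theorem re_zeta : zeta.re = theta / 2 := by
  have h := Complex.exp_ofReal_mul_I_re (2 * Real.pi / 9)
  push_cast at h
  rw [zeta, h, theta]
  ring

theorem re_zeta_pow_seven : (zeta ^ 7).re = (theta ^ 2 - 2) / 2 := by
  have h9 : zeta ^ 9 = 1 := by
    rw [show 9 = 3 * 3 by rfl, pow_mul, zeta_cube, omega_cube]
  have h1 : (starRingEnd ℂ) zeta * zeta = 1 := by rw [Complex.conj_mul', norm_zeta]; simp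
  have h2 : zeta ^ 7 = (starRingEnd ℂ) (zeta ^ 2) := by
    rw [map_pow]
    linear_combination zeta ^ 7 * (-((starRingEnd ℂ) zeta * zeta) - 1) * h1 +
      ((starRingEnd ℂ) zeta) ^ 2 * h9
  have h3 : zeta.re * zeta.re + zeta.im * zeta.im = 1 := by
    have := congrArg Complex.re h1
    simpa using this
  rw [h2, Complex.conj_re, pow_two, Complex.mul_re]
  rw [re_zeta] at h3 ⊢
  linarith

/-- Alice's observables in an optimal strategy. For the observables `optY`, the operator `∑_l ω^{kl}
Y_l` is the weighted shift with weights `∑_l ω^{l² + (k + i) l} = (1 + 2ω) ω^{-(k + i)²}`; the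
weights of `X_k` cancel the phases `ω^{-(k + i)²}`. The factor `ζ⁷` is the one among the cube roots
of `ω`, which make `X_k³ = 1`, that maximizes the real part of `ζ⁷ (1 + 2ω)`. -/
def optX (k : Fin 3) : Matrix (Fin 3) (Fin 3) ℂ :=
  weightedShift fun i => zeta ^ (7 + 3 * ((k : ℕ) + 1 + i) ^ 2)

/-- Bob's observables in an optimal strategy. -/
def optY (l : Fin 3) : Matrix (Fin 3) (Fin 3) ℂ :=
  weightedShift fun i => zeta ^ (3 * (((l : ℕ) + 1) ^ 2 + i * ((l : ℕ) + 1)))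

/-- The maximally entangled state of two qutrits. -/
def optState : EuclideanSpace ℂ (Fin 3 × Fin 3) :=
  WithLp.toLp 2 fun p => if p.1 = p.2 then ((1 / √3 : ℝ) : ℂ) else 0

theorem zeta_pow_eq_one {e : ℕ} (h : e % 9 = 0) : zeta ^ e = 1 := by
  obtain ⟨d, rfl⟩ := Nat.dvd_of_mod_eq_zero h
  rw [show 9 * d = 3 * (3 * d) by ring, pow_mul, zeta_cube, pow_mul, omega_cube, one_pow]

theorem norm_optState : ‖optState‖ = 1 := by
  rw [EuclideanSpace.norm_eq, Real.sqrt_eq_one, Fintype.sum_prod_type]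
  simp [optState, Fin.sum_univ_three]
  norm_num

theorem isFeasible_opt : IsFeasible (fun i => opA (n := Fin 3) (optX i))
    (fun i => opB (m := Fin 3) (optY i)) := by
  refine isFeasible_op (fun i => weightedShift_mem_unitary fun j => ?_)
    (fun i => weightedShift_mem_unitary fun j => ?_)
    (fun i => weightedShift_cube ?_) (fun i => weightedShift_cube ?_)
  · rw [norm_pow, norm_zeta, one_pow]
  · rw [norm_pow, norm_zeta, one_pow]
  · rw [← pow_add, ← pow_add]
    fin_cases i <;> exact zeta_pow_eq_one rfl
  · rw [← pow_add, ← pow_add]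
    fin_cases i <;> exact zeta_pow_eq_one rfl

theorem inner_opt_kronecker (a b : Fin 3 → ℂ) :
    inner ℂ optState ((opA (n := Fin 3) (weightedShift a) *
      opB (m := Fin 3) (weightedShift b)) optState) = 1 / 3 * ∑ i, a i * b i := by
  have h3 : ((√3 : ℝ) : ℂ)⁻¹ * ((√3 : ℝ) : ℂ)⁻¹ = 1 / 3 := by
    rw [← mul_inv, ← Complex.ofReal_mul, Real.mul_self_sqrt (by norm_num)]; norm_num
  rw [opA, opB, ← map_mul, ← Matrix.mul_kronecker_mul, one_mul, mul_one, inner_toEuclideanCLM_eq]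
  simp only [dotProduct, Matrix.mulVec, Fintype.sum_prod_type, Fin.sum_univ_three, optState,
    Matrix.kronecker_apply, weightedShift, Pi.star_apply]
  simp
  linear_combination (a 0 * b 0 + a 1 * b 1 + a 2 * b 2) * h3

theorem re_inner_sum_twist_opt : (inner ℂ optState ((∑ k, ∑ l,
    twist (fun i => opA (n := Fin 3) (optX i)) (fun i => opB (m := Fin 3) (optY i)) k l)
      optState)).re = 3 * tau / 2 := by
  have h : ∀ k l, inner ℂ optState ((twist (fun i => opA (n := Fin 3) (optX i))
      (fun i => opB (m := Fin 3) (optY i)) k l) optState) = 1 / 3 *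
      ∑ i : Fin 3, zeta ^ ((3 * (((k : ℕ) + 1) * ((l : ℕ) + 1)) + (7 + 3 * ((k : ℕ) + 1 + i) ^ 2) +
        3 * (((l : ℕ) + 1) ^ 2 + i * ((l : ℕ) + 1))) % 9) := by
    intro k l
    have h1 := inner_opt_kronecker (fun i => zeta ^ (7 + 3 * ((k : ℕ) + 1 + i) ^ 2))
      (fun i => zeta ^ (3 * (((l : ℕ) + 1) ^ 2 + i * ((l : ℕ) + 1))))
    rw [twist, smul_apply, inner_smul_right, optX, optY, h1, ← zeta_cube, ← pow_mul,
      mul_left_comm, Finset.mul_sum]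
    simp only [← pow_eq_pow_mod _ (zeta_pow_eq_one (e := 9) rfl), pow_add, mul_assoc]
  simp only [sum_apply, inner_sum, h]
  have h2 : (∑ k : Fin 3, ∑ l : Fin 3, 1 / 3 * ∑ i : Fin 3,
      zeta ^ ((3 * (((k : ℕ) + 1) * ((l : ℕ) + 1)) + (7 + 3 * ((k : ℕ) + 1 + i) ^ 2) +
        3 * (((l : ℕ) + 1) ^ 2 + i * ((l : ℕ) + 1))) % 9) : ℂ) =
      ((3 : ℝ) : ℂ) * zeta ^ 7 + ((6 : ℝ) : ℂ) * zeta := by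
    simp [Fin.sum_univ_three]
    ring
  rw [h2, Complex.add_re, Complex.re_ofReal_mul, Complex.re_ofReal_mul, re_zeta,
    re_zeta_pow_seven, tau]
  ring

theorem re_inner_chshPoly_eq {E : Type*} [NormedAddCommGroup E] [InnerProductSpace ℂ E]
    [CompleteSpace E] {x y : Fin 3 → (E →L[ℂ] E)} (hf : IsFeasible x y) (v : E) :
    27 * (inner ℂ v (chshPoly x y v)).re =
      9 * ‖v‖ ^ 2 + 2 * (inner ℂ v ((∑ k, ∑ l, twist x y k l) v)).re := by
  set T := ∑ k, ∑ l, twist x y k l with hT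
  have h1 : (27 : ℂ) • chshPoly x y = (9 : ℂ) • (1 : E →L[ℂ] E) + (T + star T) := by
    rw [chshPoly_eq_twist hf.cube_X hf.cube_Y hf.commute, Algebra.algebraMap_eq_smul_one, hT]
    simp only [star_sum, star_twist hf, Finset.sum_add_distrib, pow_two]
  have h2 := congrArg (fun P : E →L[ℂ] E => (inner ℂ v (P v)).re) h1
  have h3 : (inner ℂ v (star T v)).re = (inner ℂ v (T v)).re := by
    rw [ContinuousLinearMap.star_eq_adjoint, ContinuousLinearMap.adjoint_inner_right,
      ← inner_conj_symm, Complex.conj_re]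
  have h4 : (inner ℂ v v).re = ‖v‖ ^ 2 := inner_self_eq_norm_sq (𝕜 := ℂ) v
  simp only [smul_apply, add_apply, one_apply_eq_self, inner_add_right, inner_smul_right,
    Complex.add_re, h3] at h2
  rw [← Complex.ofReal_ofNat, ← Complex.ofReal_ofNat, Complex.re_ofReal_mul,
    Complex.re_ofReal_mul, h4] at h2
  rw [h2]
  ring

theorem beta_le_betaQ : beta ≤ betaQ := by
  refine le_csSup bddAbove_quantumValues ⟨_, _, _, inferInstance, _, _, optState, isFeasible_opt,
    norm_optState, ?_⟩
  have h1 := re_inner_chshPoly_eq isFeasible_opt optState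
  rw [re_inner_sum_twist_opt, norm_optState] at h1
  rw [beta]
  linarith

/-! ### Algebraic consequences of optimality -/

section Null

variable {V : Type*} [AddCommGroup V] [Module ℂ V]

/-- The vector `v` is annihilated by all polynomials of the certificate, evaluated at the operators
`z₀, z₁, z₂` in any order. -/
def IsNull (z : Fin 3 → Module.End ℂ V) (v : V) : Prop :=
  ∀ σ ∈ perms, ∀ B ∈ blocks, ∀ i < B.size, eval (z ∘ σ) (B.vec i) v = 0

variable {z : Fin 3 → Module.End ℂ V} {v : V}

theorem val_ofInt_neg_one : (CubicInt.ofInt (-1)).val = -1 := by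
  rw [CubicInt.val_ofInt]; norm_num

theorem eval_lin_single (p : NCPoly) (w : V) :
    eval z (lin [(⟨1, 0, 0⟩, p)]) w = eval z p w := by
  have h1 : (CubicInt.val ⟨1, 0, 0⟩ : ℝ) = 1 := by simp [CubicInt.val]
  simp [lin, eval_add, eval_smul, eval, h1]

/-- The products `z_i z_j z_k` of the three operators agree on `v` if their orders differ by a
cyclic permutation. -/
theorem IsNull.cyclic (h : IsNull z v) :
    (z 0 (z 1 (z 2 v)) = z 1 (z 2 (z 0 v)) ∧ z 1 (z 2 (z 0 v)) = z 2 (z 0 (z 1 v))) ∧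
    (z 0 (z 2 (z 1 v)) = z 2 (z 1 (z 0 v)) ∧ z 2 (z 1 (z 0 v)) = z 1 (z 0 (z 2 v))) := by
  have hd : ∀ σ ∈ perms, ∀ i < 12, eval (z ∘ σ) (stdBlock.vec i) v = 0 := fun σ hσ i hi =>
    h σ hσ stdBlock (by simp [blocks]) i hi
  have e1 : ∀ σ : Fin 3 → Fin 3, σ ∈ perms →
      z (σ 1) (z (σ 2) (z (σ 0) v)) + z (σ 2) (z (σ 1) (z (σ 0) v)) -
        (z (σ 0) (z (σ 1) (z (σ 2) v)) + z (σ 0) (z (σ 2) (z (σ 1) v))) = 0 := by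
    intro σ hσ
    have h6 := hd σ hσ 6 (by norm_num)
    simp only [Block.vec, stdBlock, List.getD_cons_succ, List.getD_cons_zero] at h6
    rw [eval_lin_single] at h6
    simp only [diff, pair, eval_add, eval_smul, eval_mono, val_ofInt_neg_one, List.map_cons,
      List.map_nil, List.prod_cons, List.prod_nil, mul_one, LinearMap.add_apply,
      Module.End.mul_apply, Module.algebraMap_end_apply, Function.comp_apply, Complex.ofReal_neg,
      Complex.ofReal_one, neg_smul, one_smul] at h6
    rw [sub_eq_add_neg]
    exact h6
  have e2 : ∀ σ : Fin 3 → Fin 3, σ ∈ perms →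
      z (σ 2) (z (σ 0) (z (σ 1) v)) + z (σ 1) (z (σ 0) (z (σ 2) v)) -
        (z (σ 0) (z (σ 1) (z (σ 2) v)) + z (σ 0) (z (σ 2) (z (σ 1) v))) = 0 := by
    intro σ hσ
    have h7 := hd σ hσ 7 (by norm_num)
    simp only [Block.vec, stdBlock, List.getD_cons_succ, List.getD_cons_zero] at h7
    rw [eval_lin_single] at h7
    simp only [diff, pair, eval_add, eval_smul, eval_mono, val_ofInt_neg_one, List.map_cons,
      List.map_nil, List.prod_cons, List.prod_nil, mul_one, LinearMap.add_apply,
      Module.End.mul_apply, Module.algebraMap_end_apply, Function.comp_apply, Complex.ofReal_neg,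
      Complex.ofReal_one, neg_smul, one_smul] at h7
    rw [sub_eq_add_neg]
    exact h7
  have a1 := e1 (fun l => l) (by simp [perms])
  have a2 := e2 (fun l => l) (by simp [perms])
  have b1 := e1 (fun l => l + 1) (by simp [perms])
  have b2 := e2 (fun l => l + 1) (by simp [perms])
  simp only [Fin.isValue, zero_add, show (1 : Fin 3) + 1 = 2 from rfl,
    show (2 : Fin 3) + 1 = 0 from rfl] at b1 b2
  generalize z 0 (z 1 (z 2 v)) = p0 at *
  generalize z 1 (z 2 (z 0 v)) = p1 at *
  generalize z 2 (z 0 (z 1 v)) = p2 at *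
  generalize z 0 (z 2 (z 1 v)) = q0 at *
  generalize z 2 (z 1 (z 0 v)) = q1 at *
  generalize z 1 (z 0 (z 2 v)) = q2 at *
  -- The four equations are `p₁ + q₁ = p₀ + q₀ = p₂ + q₂` and `p₂ + q₀ = p₁ + q₂ = p₀ + q₁`.
  have hp : p0 = p1 := by
    have : (3 : ℂ) • (p0 - p1) = 0 := by
      linear_combination (norm := module) (-2 : ℂ) • a1 + a2 - b1 + (2 : ℂ) • b2
    exact sub_eq_zero.1 ((smul_eq_zero.1 this).resolve_left (by norm_num))
  have hp' : p1 = p2 := by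
    have : (3 : ℂ) • (p1 - p2) = 0 := by
      linear_combination (norm := module) a1 - (2 : ℂ) • a2 - b1 - b2
    exact sub_eq_zero.1 ((smul_eq_zero.1 this).resolve_left (by norm_num))
  subst hp hp'
  refine ⟨⟨rfl, rfl⟩, ?_, ?_⟩
  · rw [add_sub_add_left_eq_sub, sub_eq_zero] at a1
    exact a1.symm
  · rw [add_sub_add_left_eq_sub, sub_eq_zero] at b2
    exact b2

/-- On `v`, the sum `Z` of the three operators satisfies `(τ² - 3) Z = Z³ + 3 τ`, and the sum of
their squares is `3` times an inverse of `Z`. -/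
theorem IsNull.sum_apply (hz : ∀ l, z l ^ 3 = 1) (h : IsNull z v) :
    (∑ l, z l ^ 2) ((∑ l, z l) v) = (3 : ℂ) • v ∧
    ((tau : ℂ) ^ 2 - 3) • (∑ l, z l) v =
      ((∑ l, z l) ^ 3 + algebraMap ℂ (Module.End ℂ V) (3 * tau)) v := by
  have hd : ∀ i < 8, eval z (trivBlock.vec i) v = 0 := fun i hi =>
    h (fun l => l) (by simp [perms]) trivBlock (by simp [blocks]) i hi
  have h0 := hd 0 (by norm_num)
  have h1 := hd 1 (by norm_num)
  have h2 := hd 2 (by norm_num)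
  simp only [Block.vec, trivBlock, List.getD_cons_succ, List.getD_cons_zero] at h0 h1 h2
  rw [eval_lin_single] at h1 h2
  have hc : (CubicInt.val ⟨2, -2, -1⟩ : ℝ) = -tau := by
    simp only [CubicInt.val, tau]; push_cast; ring
  have hc1 : (CubicInt.val ⟨1, 0, 0⟩ : ℝ) = 1 := by simp [CubicInt.val]
  set Z := ∑ l, z l with hZ
  set Z' := ∑ l, z l ^ 2 with hZ'
  have h0' : Z' v = (tau : ℂ) • v - Z v := by
    simp only [lin, eval_add, eval_smul, eval_rot_zero, eval_rot_zero_zero, eval_mono, hc, hc1,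
      eval, LinearMap.add_apply, Module.End.mul_apply, Module.algebraMap_end_apply, List.map_nil,
      List.prod_nil, Module.End.one_apply, add_zero, Complex.ofReal_neg,
      Complex.ofReal_one, one_smul, ← hZ, ← hZ'] at h0
    linear_combination (norm := module) h0
  have hcube : ∀ l w, z l (z l (z l w)) = w := fun l w => congrArg (fun T => T w) (hz l)
  simp only [sym, rot, eval_add, eval_mono, List.map_cons, List.map_nil, List.prod_cons,
    List.prod_nil, mul_one, LinearMap.add_apply, Module.End.mul_apply, Fin.isValue, Fin.reduceAdd,
    show (-1 : Fin 3) = 2 from rfl, show (-2 : Fin 3) = 1 from rfl] at h1 h2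
  have h1' : Z (Z' v) = (3 : ℂ) • v := by
    simp only [hZ, hZ', Fin.sum_univ_three, pow_two, LinearMap.add_apply, Module.End.mul_apply,
      map_add, hcube]
    linear_combination (norm := module) h1
  have h2' : Z' (Z v) = (3 : ℂ) • v := by
    simp only [hZ, hZ', Fin.sum_univ_three, pow_two, LinearMap.add_apply, Module.End.mul_apply,
      map_add, hcube]
    linear_combination (norm := module) h2
  have h3 : Z (Z v) = (tau : ℂ) • Z v - (3 : ℂ) • v := by
    rw [h0', map_sub, map_smul] at h1'
    rw [← h1', sub_sub_cancel]
  refine ⟨h2', ?_⟩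
  have h4 : (Z ^ 3) v = Z (Z (Z v)) := rfl
  rw [LinearMap.add_apply, h4, Module.algebraMap_end_apply, h3, map_sub, map_smul, map_smul, h3]
  module

end Null

/-! ### The stabilizer of an optimal vector -/

section Stabilizer

variable {V : Type*} [AddCommGroup V] [Module ℂ V] {x y : Fin 3 → Module.End ℂ V} {v : V}

theorem tau_sq_ne_three : (tau : ℂ) ^ 2 - 3 ≠ 0 := by
  have h1 : (3 / 2 : ℝ) < theta := by
    refine lt_of_lt_of_le ?_ lt_theta.le
    norm_num [thetaApprox]
  have h2 : 3 < tau ^ 2 := by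
    have : 2 < tau := by rw [tau]; nlinarith
    nlinarith
  have h3 : tau ^ 2 - 3 ≠ 0 := by linarith
  exact_mod_cast h3

/-- On a vector annihilated by the certificate, every operator of one party acts like a polynomial
in the operators of the other party. -/
theorem exists_transfer (hx : ∀ i, x i ^ 3 = 1) (hy : ∀ i, y i ^ 3 = 1)
    (hxy : ∀ i j, x i * y j = y j * x i) (h : ∀ k, IsNull (twist x y k) v) (k : Fin 3) :
    ∃ b : Module.End ℂ V, (∀ D, (∀ l, Commute D (y l)) → Commute D b) ∧ x k v = b v := by
  obtain ⟨h1, h2⟩ := (h k).sum_apply (twist_cube hx hy hxy k)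
  set W := ∑ l : Fin 3, omega ^ (((k : ℕ) + 1) * ((l : ℕ) + 1)) • y l with hW
  set W' := ∑ l : Fin 3, omega ^ (((k : ℕ) + 1) * ((l : ℕ) + 1) * 2) • y l ^ 2 with hW'
  have e1 : ∑ l, twist x y k l = x k * W := by
    simp only [hW, Finset.mul_sum, twist, mul_smul_comm]
  have e2 : ∑ l, twist x y k l ^ 2 = x k ^ 2 * W' := by
    simp only [hW', Finset.mul_sum, twist_pow hxy, mul_smul_comm]
  have hyD : ∀ D, (∀ l, Commute D (y l)) → Commute D W ∧ Commute D W' := fun D hD =>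
    ⟨Commute.sum_right _ _ _ fun l _ => (hD l).smul_right _,
      Commute.sum_right _ _ _ fun l _ => ((hD l).pow_right 2).smul_right _⟩
  have hxW : Commute (x k) W ∧ Commute (x k) W' := hyD _ fun l => hxy k l
  set c := ((tau : ℂ) ^ 2 - 3)⁻¹ with hc
  -- `(x k * W) ^ 3 = W ^ 3`, which expresses `x k * W` on `v` in the other party's operators.
  have e3 : x k (W v) = c • (W ^ 3 + algebraMap ℂ (Module.End ℂ V) (3 * tau)) v := by
    rw [e1, hxW.1.mul_pow, hx, one_mul] at h2
    rw [← h2, smul_smul, hc, inv_mul_cancel₀ tau_sq_ne_three, one_smul]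
    rfl
  have e4 : W' (W v) = (3 : ℂ) • v := by
    rw [e1, e2] at h1
    rw [← h1]
    change (W' * W) v = ((x k ^ 2 * W') * (x k * W)) v
    congr 1
    rw [mul_assoc, ← mul_assoc W', ← hxW.2.eq, mul_assoc, ← mul_assoc, ← pow_succ, hx, one_mul]
  refine ⟨(1 / 3 : ℂ) • (W' * (c • (W ^ 3 + algebraMap ℂ (Module.End ℂ V) (3 * tau)))),
    fun D hD => ?_, ?_⟩
  · obtain ⟨hD1, hD2⟩ := hyD D hD
    exact (hD2.mul_right (((hD1.pow_right 3).add_right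
      (Algebra.commute_algebraMap_right _ _)).smul_right _)).smul_right _
  · rw [LinearMap.smul_apply, Module.End.mul_apply, LinearMap.smul_apply, ← e3]
    have e5 : W' (x k (W v)) = x k (W' (W v)) := (congrArg (fun T => T (W v)) hxW.2.eq).symm
    rw [e5, e4, map_smul, smul_smul]
    norm_num

/-- Words that agree in `G` act equally on a vector annihilated by the certificates of both
parties: its stabilizer is normal, because the operators of one party act on it like operators of
the other party, which commute with the former. -/
theorem apply_eq_of_mk_eq (hx : ∀ i, x i ^ 3 = 1) (hy : ∀ i, y i ^ 3 = 1)
    (hxy : ∀ i j, x i * y j = y j * x i) (h : ∀ k, IsNull (twist x y k) v)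
    (h' : ∀ k, IsNull (twist y x k) v) (F : FreeGroup (Fin 3) →* Module.End ℂ V)
    (hF : ∀ i, F (FreeGroup.of i) = x i) {g g' : FreeGroup (Fin 3)}
    (hg : PresentedGroup.mk relators g = PresentedGroup.mk relators g') : F g v = F g' v := by
  have hinv : ∀ i, F (FreeGroup.of i)⁻¹ = x i ^ 2 := by
    intro i
    have h1 : F (FreeGroup.of i)⁻¹ * x i = 1 := by rw [← hF, ← map_mul, inv_mul_cancel, map_one]
    calc F (FreeGroup.of i)⁻¹ = F (FreeGroup.of i)⁻¹ * x i ^ 3 := by rw [hx, mul_one]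
      _ = (F (FreeGroup.of i)⁻¹ * x i) * x i ^ 2 := by rw [pow_succ' (x i) 2, mul_assoc]
      _ = x i ^ 2 := by rw [h1, one_mul]
  have hcomm : ∀ D : Module.End ℂ V, (∀ i, Commute D (x i)) → ∀ u, Commute D (F u) := by
    intro D hD u
    induction u using FreeGroup.induction_on with
    | C1 => rw [map_one]; exact Commute.one_right D
    | of i => rw [hF]; exact hD i
    | inv_of i _ => rw [hinv]; exact (hD i).pow_right 2
    | mul u w hu hw => rw [map_mul]; exact hu.mul_right hw
  -- Every word acts on `v` like an operator that commutes with all words.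
  have hb : ∀ u, ∃ b : Module.End ℂ V, (∀ i, Commute b (x i)) ∧ F u v = b v := by
    have hgen : ∀ i, ∃ b : Module.End ℂ V, (∀ i, Commute b (x i)) ∧ x i v = b v := by
      intro i
      obtain ⟨b, hb, hbv⟩ := exists_transfer hx hy hxy h i
      exact ⟨b, fun j => (hb (x j) fun l => hxy j l).symm, hbv⟩
    have hmul : ∀ S T : Module.End ℂ V, (∃ a : Module.End ℂ V, (∀ i, Commute a (x i)) ∧ S v = a v) →
        (∃ b : Module.End ℂ V, (∀ i, Commute b (x i)) ∧ T v = b v) → (∀ b : Module.End ℂ V,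
          (∀ i, Commute b (x i)) → Commute b S) →
        ∃ b : Module.End ℂ V, (∀ i, Commute b (x i)) ∧ (S * T) v = b v := by
      rintro S T ⟨a, ha, hav⟩ ⟨b, hb, hbv⟩ hS
      refine ⟨b * a, fun i => (hb i).mul_left (ha i), ?_⟩
      rw [Module.End.mul_apply, hbv, Module.End.mul_apply, ← hav]
      exact (congrArg (fun T => T v) (hS b hb).eq).symm
    intro u
    induction u using FreeGroup.induction_on with
    | C1 => exact ⟨1, fun i => Commute.one_left _, by rw [map_one]⟩
    | of i => rw [hF]; exact hgen i
    | inv_of i _ =>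
      rw [hinv, pow_two]
      exact hmul _ _ (hgen i) (hgen i) fun b hb => hb i
    | mul u w hu hw =>
      rw [map_mul]
      exact hmul _ _ hu hw fun b hb => hcomm b hb u
  let N : Subgroup (FreeGroup (Fin 3)) :=
    { carrier := {u | F u v = v}
      one_mem' := by simp
      mul_mem' := fun {a b} ha hb => by
        simp only [Set.mem_ofPred_eq] at ha hb ⊢
        rw [map_mul, Module.End.mul_apply, hb, ha]
      inv_mem' := fun {a} ha => by
        simp only [Set.mem_ofPred_eq] at ha ⊢
        conv_lhs => rw [← ha]
        rw [← Module.End.mul_apply, ← map_mul, inv_mul_cancel, map_one, Module.End.one_apply] }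
  have hN : N.Normal := by
    refine ⟨fun u (hu : F u v = v) w => ?_⟩
    obtain ⟨b, hb, hbv⟩ := hb w⁻¹
    change F (w * u * w⁻¹) v = v
    have h1 : F u (b v) = b v := by
      conv_rhs => rw [← hu]
      exact (congrArg (fun T => T v) (hcomm b hb u).eq).symm
    rw [map_mul, map_mul, Module.End.mul_apply, Module.End.mul_apply, hbv, h1, ← hbv,
      ← Module.End.mul_apply, ← map_mul, mul_inv_cancel, map_one, Module.End.one_apply]
  have hrel : relators ⊆ N := by
    rintro r (⟨i, rfl⟩ | ⟨i, j, k, h₁, h₂, h₃, rfl⟩)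
    · change F (FreeGroup.of i ^ 3) v = v
      rw [map_pow, hF, hx, Module.End.one_apply]
    -- The cyclic relation puts `(kij)⁻¹ (ijk)` into the stabilizer, and normality `(ijk) (kij)⁻¹`.
    · refine hN.mem_comm ?_
      change F ((FreeGroup.of k * FreeGroup.of i * FreeGroup.of j)⁻¹ *
        (FreeGroup.of i * FreeGroup.of j * FreeGroup.of k)) v = v
      -- The index `2` stands for the question `3`, at which the phases `ω^{kl}` are trivial.
      have h3 : ∀ m, twist y x 2 m = y 2 * x m := by
        intro m
        rw [twist, show ((2 : Fin 3) : ℕ) + 1 = 3 from rfl, pow_mul, omega_cube, one_pow, one_smul]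
      have hyinj : ∀ a b c a' b' c', twist y x 2 a (twist y x 2 b (twist y x 2 c v)) =
          twist y x 2 a' (twist y x 2 b' (twist y x 2 c' v)) →
          x a (x b (x c v)) = x a' (x b' (x c' v)) := by
        intro a b c a' b' c' e
        have hc : ∀ a b c, twist y x 2 a (twist y x 2 b (twist y x 2 c v)) =
            x a (x b (x c v)) := by
          intro a b c
          simp only [h3]
          change ((y 2 * x a) * ((y 2 * x b) * (y 2 * x c))) v = _
          have : (y 2 * x a) * ((y 2 * x b) * (y 2 * x c)) = y 2 ^ 3 * (x a * (x b * x c)) := by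
            simp only [pow_succ, pow_zero, one_mul, mul_assoc]
            rw [← mul_assoc (x b), hxy b, ← mul_assoc (x a), hxy a, mul_assoc, mul_assoc,
              ← mul_assoc (x a) (y 2), hxy a]
            simp only [mul_assoc]
          rw [this, hy, one_mul]
          rfl
        rwa [hc, hc] at e
      obtain ⟨⟨c1, c2⟩, c3, c4⟩ := (h' 2).cyclic
      have key : x i (x j (x k v)) = x k (x i (x j v)) := by
        have a1 := hyinj _ _ _ _ _ _ c1
        have a2 := hyinj _ _ _ _ _ _ c2
        have a3 := hyinj _ _ _ _ _ _ c3
        have a4 := hyinj _ _ _ _ _ _ c4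
        fin_cases i <;> fin_cases j <;> fin_cases k <;> simp at h₁ h₂ h₃ <;>
          simp [a1, a2, a3, a4]
      have h4 : F (FreeGroup.of i * FreeGroup.of j * FreeGroup.of k) v =
          F (FreeGroup.of k * FreeGroup.of i * FreeGroup.of j) v := by
        simp only [map_mul, hF]
        exact key
      rw [map_mul, Module.End.mul_apply, h4, ← Module.End.mul_apply, ← map_mul, inv_mul_cancel,
        map_one, Module.End.one_apply]
  have hle : Subgroup.normalClosure relators ≤ N := Subgroup.normalClosure_le_normal hrel
  have hm : g'⁻¹ * g ∈ N := hle (QuotientGroup.eq.1 hg.symm)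
  change F (g'⁻¹ * g) v = v at hm
  conv_rhs => rw [← hm]
  rw [← Module.End.mul_apply, ← map_mul, mul_inv_cancel_left]

end Stabilizer

/-! ### The limit of all near-optimal strategies -/

/-- A strategy on some Hilbert space, with a vector `v` that need not be normalized and at which the
value is within `ε` of `β ‖v‖²`. Alice's observables are the values at the generators of a unitary
representation `F` of the free group. -/
structure NearOptimal where
  H : Type
  [normed : NormedAddCommGroup H]
  [inner : InnerProductSpace ℂ H]
  [complete : CompleteSpace H]
  F : FreeGroup (Fin 3) →* (H →L[ℂ] H)
  y : Fin 3 → (H →L[ℂ] H)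
  v : H
  ε : ℝ
  F_mem : ∀ u, F u ∈ unitary (H →L[ℂ] H)
  feasible : IsFeasible (fun i => F (FreeGroup.of i)) y
  defect_le : beta * ‖v‖ ^ 2 -
    (Inner.inner ℂ v (chshPoly (fun i => F (FreeGroup.of i)) y v)).re ≤ ε

theorem IsFeasible.swap {R : Type*} [Ring R] [StarRing R] {X Y : Fin 3 → R}
    (h : IsFeasible X Y) : IsFeasible Y X :=
  ⟨h.unitary_Y, h.unitary_X, h.cube_Y, h.cube_X, fun i j => (h.commute j i).symm⟩

theorem eval_apply_eq {E : Type*} [NormedAddCommGroup E] [InnerProductSpace ℂ E]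
    (y : Fin 3 → (E →L[ℂ] E)) (p : NCPoly) (v : E) :
    eval y p v = eval (A := Module.End ℂ E) (fun l => (y l : E →ₗ[ℂ] E)) p v := by
  induction p with
  | zero => rfl
  | node c p q r hp hq hr =>
    simp only [eval, LinearMap.add_apply, Module.End.mul_apply, ← hp, ← hq, ← hr]
    rw [Algebra.algebraMap_eq_smul_one, Algebra.algebraMap_eq_smul_one]
    rfl

theorem norm_apply_of_mem_unitary {E : Type*} [NormedAddCommGroup E] [InnerProductSpace ℂ E]
    [CompleteSpace E] {U : E →L[ℂ] E} (hU : U ∈ unitary (E →L[ℂ] E)) (v : E) : ‖U v‖ = ‖v‖ :=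
  Unitary.norm_map ⟨U, hU⟩ v

namespace NearOptimal

attribute [instance] normed inner complete

/-- Alice's observables. -/
def x (s : NearOptimal) (i : Fin 3) : s.H →L[ℂ] s.H := s.F (FreeGroup.of i)

theorem ε_nonneg (s : NearOptimal) : 0 ≤ s.ε :=
  (sub_nonneg.2 (re_inner_chshPoly_le s.feasible s.v)).trans s.defect_le

/-- Families of vectors, one for every near-optimal strategy. -/
abbrev Family : Type 1 := (s : NearOptimal) → s.H

/-- The families `u` with `‖u‖² = O(ε)`. -/
def negligible : Submodule ℂ Family where
  carrier := {u | ∃ C : ℝ, ∀ s, ‖u s‖ ^ 2 ≤ C * s.ε}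
  zero_mem' := ⟨0, fun s => by simp⟩
  add_mem' := by
    rintro u u' ⟨C, hC⟩ ⟨C', hC'⟩
    refine ⟨2 * C + 2 * C', fun s => ?_⟩
    have h1 : ‖u s + u' s‖ ^ 2 ≤ (‖u s‖ + ‖u' s‖) ^ 2 := by gcongr; exact norm_add_le _ _
    have h2 := hC s
    have h3 := hC' s
    change ‖u s + u' s‖ ^ 2 ≤ _
    nlinarith [sq_nonneg (‖u s‖ - ‖u' s‖)]
  smul_mem' := by
    rintro c u ⟨C, hC⟩
    refine ⟨‖c‖ ^ 2 * C, fun s => ?_⟩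
    change ‖c • u s‖ ^ 2 ≤ _
    rw [norm_smul, mul_pow, mul_assoc]
    exact mul_le_mul_of_nonneg_left (hC s) (sq_nonneg _)

/-- The space of families modulo `O(√ε)`, on which near-optimality becomes optimality. -/
abbrev Limit : Type 1 := Family ⧸ negligible

/-- The class of a family. -/
abbrev classOf (u : Family) : Limit := Submodule.Quotient.mk u

theorem Limit.hom_ext {S T : Module.End ℂ Limit} (h : ∀ u, S (classOf u) = T (classOf u)) :
    S = T :=
  Submodule.linearMap_qext _ (LinearMap.ext h)

/-- The operator on `Limit` given by a family of unitaries. -/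
def limitOp (T : (s : NearOptimal) → (s.H →L[ℂ] s.H)) (hT : ∀ s, T s ∈ unitary (s.H →L[ℂ] s.H)) :
    Module.End ℂ Limit :=
  negligible.mapQ negligible
    (LinearMap.pi fun s => (T s : s.H →ₗ[ℂ] s.H) ∘ₗ LinearMap.proj s) (by
      rintro u ⟨C, hC⟩
      refine ⟨C, fun s => ?_⟩
      change ‖T s (u s)‖ ^ 2 ≤ _
      rw [norm_apply_of_mem_unitary (hT s)]
      exact hC s)

theorem limitOp_classOf {T : (s : NearOptimal) → (s.H →L[ℂ] s.H)} (hT) (u : Family) :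
    limitOp T hT (classOf u) = classOf fun s => T s (u s) := rfl

theorem limitOp_eq_one {T : (s : NearOptimal) → (s.H →L[ℂ] s.H)} (hT) (h : ∀ s, T s = 1) :
    limitOp T hT = 1 :=
  Limit.hom_ext fun u => by simp only [limitOp_classOf, h]; rfl

theorem limitOp_eq_mul {T T₁ T₂ : (s : NearOptimal) → (s.H →L[ℂ] s.H)} (hT hT₁ hT₂)
    (h : ∀ s, T s = T₁ s * T₂ s) : limitOp T hT = limitOp T₁ hT₁ * limitOp T₂ hT₂ :=
  Limit.hom_ext fun u => by simp only [limitOp_classOf, h]; rfl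

/-- Alice's observables on `Limit`, as a representation of the free group. -/
def limitF : FreeGroup (Fin 3) →* Module.End ℂ Limit where
  toFun u := limitOp (fun s => s.F u) (fun s => s.F_mem u)
  map_one' := limitOp_eq_one _ fun s => map_one s.F
  map_mul' a b := limitOp_eq_mul _ _ _ fun s => map_mul s.F a b

/-- Alice's observables on `Limit`. -/
def limitX (i : Fin 3) : Module.End ℂ Limit := limitF (FreeGroup.of i)

/-- Bob's observables on `Limit`. -/
def limitY (i : Fin 3) : Module.End ℂ Limit :=
  limitOp (fun s => s.y i) (fun s => s.feasible.unitary_Y i)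

/-- The state on `Limit`. -/
def limitState : Limit := classOf fun s => s.v

theorem limitX_cube (i : Fin 3) : limitX i ^ 3 = 1 := by
  rw [limitX, ← map_pow]
  exact limitOp_eq_one (fun s => s.F_mem _) fun s => by rw [map_pow]; exact s.feasible.cube_X i

theorem limitY_cube (i : Fin 3) : limitY i ^ 3 = 1 := by
  have h2 : ∀ s : NearOptimal, s.y i * s.y i ∈ unitary (s.H →L[ℂ] s.H) := fun s =>
    mul_mem (s.feasible.unitary_Y i) (s.feasible.unitary_Y i)
  have h3 : ∀ s : NearOptimal, s.y i * s.y i * s.y i ∈ unitary (s.H →L[ℂ] s.H) := fun s =>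
    mul_mem (h2 s) (s.feasible.unitary_Y i)
  rw [pow_succ, pow_two, limitY, ← limitOp_eq_mul h2 _ _ fun s => rfl,
    ← limitOp_eq_mul h3 _ _ fun s => rfl]
  exact limitOp_eq_one _ fun s => by rw [← pow_two, ← pow_succ]; exact s.feasible.cube_Y i

theorem limit_commute (i j : Fin 3) : limitX i * limitY j = limitY j * limitX i := by
  have h : ∀ s : NearOptimal, s.x i * s.y j ∈ unitary (s.H →L[ℂ] s.H) := fun s =>
    mul_mem (s.feasible.unitary_X i) (s.feasible.unitary_Y j)
  have hx : ∀ s : NearOptimal, s.x i ∈ unitary (s.H →L[ℂ] s.H) := fun s => s.F_mem _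
  have hy : ∀ s : NearOptimal, s.y j ∈ unitary (s.H →L[ℂ] s.H) := fun s => s.feasible.unitary_Y j
  exact (limitOp_eq_mul h hx hy fun s => rfl).symm.trans
    (limitOp_eq_mul h hy hx fun s => s.feasible.commute i j)

/-- If the values of the certificate at operators of the strategies have norm `O(√ε)`, then the
certificate annihilates the limit state. -/
theorem isNull_limitState {z : (s : NearOptimal) → Fin 3 → (s.H →L[ℂ] s.H)}
    {z' : Fin 3 → Module.End ℂ Limit} (hz : ∀ l u, z' l (classOf u) =
      classOf fun s => z s l (u s)) {C : ℝ} (hC : ∀ s, nullSum (z s) s.v ≤ C * s.ε) :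
    IsNull z' limitState := by
  intro σ hσ B hB i hi
  let Z : Fin 3 → Module.End ℂ Family := fun l =>
    LinearMap.pi fun s => (z s l : s.H →ₗ[ℂ] s.H) ∘ₗ LinearMap.proj s
  have h1 : eval (z' ∘ σ) (B.vec i) limitState =
      classOf (eval (Z ∘ σ) (B.vec i) fun s => s.v) :=
    (eval_intertwine negligible.mkQ (fun l u => (hz (σ l) u).symm) _ _).symm
  have h2 : ∀ s : NearOptimal, eval (Z ∘ σ) (B.vec i) (fun s => s.v) s =
      eval (z s ∘ σ) (B.vec i) s.v := by
    intro s
    have h3 := eval_intertwine (LinearMap.proj s : Family →ₗ[ℂ] s.H) (y := Z ∘ σ)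
      (y' := fun l => (z s (σ l) : s.H →ₗ[ℂ] s.H)) (fun l u => rfl)
      (B.vec i) (fun s => s.v)
    exact h3.trans (eval_apply_eq _ _ _).symm
  rw [h1, Submodule.Quotient.mk_eq_zero]
  refine ⟨C, fun s => ?_⟩
  rw [h2]
  exact (sq_norm_le_nullSum (z s) s.v hσ hB hi).trans (hC s)

theorem nullSum_twist_le (s : NearOptimal) (k : Fin 3) :
    nullSum (twist s.x s.y k) s.v ≤ 2700 * certScale * s.ε ∧
    nullSum (twist s.y s.x k) s.v ≤ 2700 * certScale * s.ε := by
  have hf : IsFeasible s.x s.y := s.feasible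
  have hd : beta * ‖s.v‖ ^ 2 - (Inner.inner ℂ s.v (chshPoly s.x s.y s.v)).re ≤ s.ε := s.defect_le
  have hc : (0 : ℝ) ≤ 2700 * certScale := by norm_num [certScale]
  have h : ∀ x y : Fin 3 → (s.H →L[ℂ] s.H),
      nullSum (twist x y k) s.v ≤ ∑ k, nullSum (twist x y k) s.v := fun x y =>
    Finset.single_le_sum (f := fun k => nullSum (twist x y k) s.v)
      (fun k _ => nullSum_nonneg _ _) (Finset.mem_univ k)
  refine ⟨(h _ _).trans ((sum_nullSum_le hf s.v).trans (mul_le_mul_of_nonneg_left hd hc)),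
    (h _ _).trans ((sum_nullSum_le hf.swap s.v).trans (mul_le_mul_of_nonneg_left ?_ hc))⟩
  rwa [chshPoly_swap hf.commute]

theorem isNull_twist (k : Fin 3) : IsNull (twist limitX limitY k) limitState :=
  isNull_limitState (z := fun s => twist s.x s.y k) (fun _ _ => rfl)
    fun s => (nullSum_twist_le s k).1

theorem isNull_twist_swap (k : Fin 3) : IsNull (twist limitY limitX k) limitState :=
  isNull_limitState (z := fun s => twist s.y s.x k) (fun _ _ => rfl)
    fun s => (nullSum_twist_le s k).2

end NearOptimal

/-- The stability of the relations of `G`: two words that agree in `G` act on every near-optimal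
state equally up to `O(√ε)`, uniformly in the strategy. -/
theorem exists_sq_norm_sub_le {g g' : FreeGroup (Fin 3)}
    (hg : PresentedGroup.mk relators g = PresentedGroup.mk relators g') :
    ∃ C : ℝ, ∀ s : NearOptimal, ‖s.F g s.v - s.F g' s.v‖ ^ 2 ≤ C * s.ε := by
  have h := apply_eq_of_mk_eq NearOptimal.limitX_cube NearOptimal.limitY_cube
    NearOptimal.limit_commute NearOptimal.isNull_twist NearOptimal.isNull_twist_swap
    NearOptimal.limitF (fun _ => rfl) hg
  exact (Submodule.Quotient.eq _).1 h

/-! ### Approximate representations -/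

theorem fMap_eq_lift {M : Type*} [Group M] (x : Fin 3 → M) (g : G) :
    fMap x g = FreeGroup.lift x (fMap FreeGroup.of g) := by
  rw [fMap, fMap, map_normalForm]
  simp only [FreeGroup.lift_apply_of]

theorem mk_fMap_of (g : G) : PresentedGroup.mk relators (fMap FreeGroup.of g) = g := by
  rw [fMap, map_normalForm]
  change normalForm gen (phi.symm g).exps = g
  rw [← phi_apply, MulEquiv.apply_symm_apply]

/-- The operators assigned to `y x⁻¹` by multiplication and by the normal form act on a near-optimal
state equally up to `O(√ε)`. -/
theorem exists_sq_norm_fMap_le : ∃ C : ℝ, 0 < C ∧ ∀ (s : NearOptimal) (a b : G),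
    ‖s.F (fMap FreeGroup.of b * (fMap FreeGroup.of a)⁻¹) s.v -
      s.F (fMap FreeGroup.of (a * b⁻¹))⁻¹ s.v‖ ^ 2 ≤ C * s.ε := by
  have h : ∀ a b : G, ∃ C : ℝ, ∀ s : NearOptimal,
      ‖s.F (fMap FreeGroup.of b * (fMap FreeGroup.of a)⁻¹) s.v -
        s.F (fMap FreeGroup.of (a * b⁻¹))⁻¹ s.v‖ ^ 2 ≤ C * s.ε := fun a b =>
    exists_sq_norm_sub_le (by simp only [map_mul, map_inv, mk_fMap_of]; group)
  choose C hC using h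
  refine ⟨∑ a, ∑ b, |C a b| + 1, by positivity, fun s a b => (hC a b s).trans ?_⟩
  refine mul_le_mul_of_nonneg_right ?_ s.ε_nonneg
  have h1 : |C a b| ≤ ∑ b, |C a b| :=
    Finset.single_le_sum (f := fun b => |C a b|) (fun _ _ => abs_nonneg _) (Finset.mem_univ b)
  have h2 : ∑ b, |C a b| ≤ ∑ a, ∑ b, |C a b| :=
    Finset.single_le_sum (f := fun a => ∑ b, |C a b|)
      (fun _ _ => Finset.sum_nonneg fun _ _ => abs_nonneg _) (Finset.mem_univ a)
  linarith [le_abs_self (C a b)]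

theorem isApproxRep_of_forall_le {n : Type*} [Fintype n] [DecidableEq n] {R : Matrix n n ℂ}
    {f : G → Matrix.unitaryGroup n ℂ} {ε : ℝ} (h : ∀ a b, normSqR R ((f a : Matrix n n ℂ) *
      (f b : Matrix n n ℂ)ᴴ - (f (a * b⁻¹) : Matrix n n ℂ)) ≤ ε) : IsApproxRep ε R f := by
  have hc : (0 : ℝ) < Fintype.card G := by exact_mod_cast Fintype.card_pos
  have h1 := Finset.sum_le_sum fun a (_ : a ∈ Finset.univ) =>
    Finset.sum_le_sum fun b (_ : b ∈ Finset.univ) => h a b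
  simp only [Finset.sum_const, Finset.card_univ, nsmul_eq_mul] at h1
  rw [IsApproxRep, one_div, inv_mul_le_iff₀ (by positivity)]
  exact h1.trans_eq (by ring)

section Tensor

variable {m n : Type*} [Fintype m] [DecidableEq m] [Fintype n] [DecidableEq n]

theorem opA_sub (A A' : Matrix m m ℂ) : opA (n := n) (A - A') = opA A - opA A' := by
  rw [opA, opA, opA, ← map_sub]
  congr 1
  ext i j
  simp [sub_mul]

theorem opB_sub (B B' : Matrix n n ℂ) : opB (m := m) (B - B') = opB B - opB B' := by
  rw [opB, opB, opB, ← map_sub]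
  congr 1
  ext i j
  simp [mul_sub]

theorem sq_norm_toEuclideanCLM_conjTranspose (M : Matrix n n ℂ) (ψ : EuclideanSpace ℂ n) :
    ‖Matrix.toEuclideanCLM (𝕜 := ℂ) Mᴴ ψ‖ ^ 2 =
      (star (ψ : n → ℂ) ⬝ᵥ ((M * Mᴴ) *ᵥ (ψ : n → ℂ))).re := by
  have h1 := inner_self_eq_norm_sq (𝕜 := ℂ) (Matrix.toEuclideanCLM (𝕜 := ℂ) Mᴴ ψ)
  rw [← h1, ← inner_toEuclideanCLM_eq, map_mul, ← Matrix.star_eq_conjTranspose, map_star,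
    ContinuousLinearMap.star_eq_adjoint, ContinuousLinearMap.adjoint_inner_left]
  rfl

theorem normSqR_partialTraceB (ψ : EuclideanSpace ℂ (m × n)) (A : Matrix m m ℂ) :
    normSqR (partialTraceB (pureDensity ψ)) A = ‖opA (n := n) Aᴴ ψ‖ ^ 2 := by
  have h : Aᴴ ⊗ₖ (1 : Matrix n n ℂ) = (A ⊗ₖ (1 : Matrix n n ℂ))ᴴ := by
    rw [Matrix.conjTranspose_kronecker, Matrix.conjTranspose_one]
  rw [opA, h, sq_norm_toEuclideanCLM_conjTranspose, ← h, ← Matrix.mul_kronecker_mul, one_mul,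
    normSqR]
  congr 1
  generalize A * Aᴴ = M
  simp only [Matrix.trace, Matrix.diag, Matrix.mul_apply, partialTraceB, pureDensity,
    Matrix.of_apply, Matrix.vecMulVec_apply, dotProduct, Matrix.mulVec, Fintype.sum_prod_type,
    Matrix.kronecker_apply, Matrix.one_apply, mul_ite, mul_one, mul_zero, ite_mul, zero_mul,
    Finset.sum_ite_eq, Finset.mem_univ, if_true, Finset.mul_sum]
  refine Finset.sum_congr rfl fun i _ => ?_
  rw [Finset.sum_comm]
  refine Finset.sum_congr rfl fun k _ => Finset.sum_congr rfl fun j _ => ?_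
  simp only [Pi.star_apply]
  ring

theorem normSqR_partialTraceA (ψ : EuclideanSpace ℂ (m × n)) (B : Matrix n n ℂ) :
    normSqR (partialTraceA (pureDensity ψ)) B = ‖opB (m := m) Bᴴ ψ‖ ^ 2 := by
  have h : (1 : Matrix m m ℂ) ⊗ₖ Bᴴ = ((1 : Matrix m m ℂ) ⊗ₖ B)ᴴ := by
    rw [Matrix.conjTranspose_kronecker, Matrix.conjTranspose_one]
  rw [opB, h, sq_norm_toEuclideanCLM_conjTranspose, ← h, ← Matrix.mul_kronecker_mul, one_mul,
    normSqR]
  congr 1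
  generalize B * Bᴴ = M
  simp only [Matrix.trace, Matrix.diag, Matrix.mul_apply, partialTraceA, pureDensity,
    Matrix.of_apply, Matrix.vecMulVec_apply, dotProduct, Matrix.mulVec,
    Fintype.sum_prod_type_right, Matrix.kronecker_apply, Matrix.one_apply, ite_mul, one_mul,
    zero_mul, Finset.mul_sum]
  refine Finset.sum_congr rfl fun i _ => ?_
  rw [Finset.sum_comm]
  refine Finset.sum_congr rfl fun k _ => Finset.sum_congr rfl fun j _ => ?_
  rw [← Finset.mul_sum, Finset.sum_ite_eq, if_pos (Finset.mem_univ k), Pi.star_apply]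
  ring

/-- The representation of the free group on `ℂᵐ ⊗ ℂⁿ` given by Alice's observables. -/
def repA (X : Fin 3 → Matrix.unitaryGroup m ℂ) :
    FreeGroup (Fin 3) →* (EuclideanSpace ℂ (m × n) →L[ℂ] EuclideanSpace ℂ (m × n)) :=
  opAHom.comp ((Matrix.unitaryGroup m ℂ).subtype.comp (FreeGroup.lift X))

/-- The representation of the free group on `ℂᵐ ⊗ ℂⁿ` given by Bob's observables. -/
def repB (Y : Fin 3 → Matrix.unitaryGroup n ℂ) :
    FreeGroup (Fin 3) →* (EuclideanSpace ℂ (m × n) →L[ℂ] EuclideanSpace ℂ (m × n)) :=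
  opBHom.comp ((Matrix.unitaryGroup n ℂ).subtype.comp (FreeGroup.lift Y))

theorem repA_apply (X : Fin 3 → Matrix.unitaryGroup m ℂ) (u : FreeGroup (Fin 3)) :
    repA (n := n) X u = opA (FreeGroup.lift X u : Matrix m m ℂ) := rfl

theorem repB_apply (Y : Fin 3 → Matrix.unitaryGroup n ℂ) (u : FreeGroup (Fin 3)) :
    repB (m := m) Y u = opB (FreeGroup.lift Y u : Matrix n n ℂ) := rfl

theorem conjTranspose_sub_fMap (X : Fin 3 → Matrix.unitaryGroup m ℂ) (a b : G) :
    ((fMap X a).1 * (fMap X b).1ᴴ - (fMap X (a * b⁻¹)).1)ᴴ =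
      (FreeGroup.lift X (fMap FreeGroup.of b * (fMap FreeGroup.of a)⁻¹)).1 -
        (FreeGroup.lift X (fMap FreeGroup.of (a * b⁻¹))⁻¹).1 := by
  rw [Matrix.conjTranspose_sub, Matrix.conjTranspose_mul, Matrix.conjTranspose_conjTranspose,
    map_mul, map_inv, map_inv, ← fMap_eq_lift, ← fMap_eq_lift, ← fMap_eq_lift]
  rfl

end Tensor

end CHSHMod3

end

open CHSHMod3

theorem lemma5 :
    ∃ C : ℝ, 0 < C ∧
      ∀ (nA nB : ℕ) (X : Fin 3 → Matrix.unitaryGroup (Fin nA) ℂ)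
        (Y : Fin 3 → Matrix.unitaryGroup (Fin nB) ℂ)
        (ψ : EuclideanSpace ℂ (Fin nA × Fin nB)) (ε : ℝ),
        (∀ i, X i ^ 3 = 1) → (∀ i, Y i ^ 3 = 1) → ‖ψ‖ = 1 →
        CHSHMod3.betaQ - CHSHMod3.strategyValue
          (fun i => (X i : Matrix (Fin nA) (Fin nA) ℂ))
          (fun i => (Y i : Matrix (Fin nB) (Fin nB) ℂ)) ψ ≤ ε →
        CHSHMod3.IsApproxRep (C * ε)
          (CHSHMod3.partialTraceB (CHSHMod3.pureDensity ψ)) (CHSHMod3.fMap X) ∧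
        CHSHMod3.IsApproxRep (C * ε)
          (CHSHMod3.partialTraceA (CHSHMod3.pureDensity ψ)) (CHSHMod3.fMap Y) := by
  obtain ⟨C, hC, h⟩ := exists_sq_norm_fMap_le
  refine ⟨C, hC, fun nA nB X Y ψ ε hX hY hψ hε => ?_⟩
  have hf : IsFeasible (fun i => repA (n := Fin nB) X (FreeGroup.of i))
      (fun i => repB (m := Fin nA) Y (FreeGroup.of i)) := by
    simp only [repA_apply, repB_apply, FreeGroup.lift_apply_of]
    exact isFeasible_op (fun i => (X i).2) (fun i => (Y i).2)
      (fun i => congrArg Subtype.val (hX i))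
      (fun i => congrArg Subtype.val (hY i))
  have hd : beta * ‖ψ‖ ^ 2 - (inner ℂ ψ (chshPoly (fun i => repA (n := Fin nB) X (FreeGroup.of i))
      (fun i => repB (m := Fin nA) Y (FreeGroup.of i)) ψ)).re ≤ ε := by
    simp only [repA_apply, repB_apply, FreeGroup.lift_apply_of]
    rw [strategyValue_eq] at hε
    rw [hψ, one_pow, mul_one]
    linarith [beta_le_betaQ]
  let sA : NearOptimal := ⟨EuclideanSpace ℂ (Fin nA × Fin nB), repA X,
    fun i => repB Y (FreeGroup.of i), ψ, ε, fun _ => opA_mem_unitary (Subtype.prop _), hf, hd⟩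
  let sB : NearOptimal := ⟨EuclideanSpace ℂ (Fin nA × Fin nB), repB Y,
    fun i => repA X (FreeGroup.of i), ψ, ε, fun _ => opB_mem_unitary (Subtype.prop _), hf.swap,
    by rwa [chshPoly_swap hf.commute]⟩
  refine ⟨isApproxRep_of_forall_le fun a b => ?_, isApproxRep_of_forall_le fun a b => ?_⟩
  · rw [normSqR_partialTraceB, conjTranspose_sub_fMap, opA_sub]
    exact h sA a b
  · rw [normSqR_partialTraceA, conjTranspose_sub_fMap, opB_sub]
    exact h sB a b
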